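/- Let $k$ be a field. A dual quasi-bialgebra over $k$ is a coassociative counital $k$-coalgebra $(A,\Delta,\varepsilon)$, $\Delta(a)=\sum a_1\otimes a_2$, with coalgebra morphisms $A\otimes A\to A$, $a\otimes b\mapsto ab$, and $u:k\to A$, $u(1)=1$, and an element $\varphi\in(A\otimes A\otimes A)^*$ invertible for the convolution product, such that for all $a,b,c,d\in A$ $$\sum a_1(b_1c_1)\,\varphi(a_2,b_2,c_2)=\sum\varphi(a_1,b_1,c_1)\,(a_2b_2)c_2,\qquad 1a=a1=a,$$ $$\sum\varphi(a_1,b_1,c_1d_1)\,\varphi(a_2b_2,c_2,d_2)=\sum\varphi(b_1,c_1,d_1)\,\varphi(a_1,b_2c_2,d_2)\,\varphi(a_2,b_3,c_3),\qquad \varphi(a,1,b)=\varepsilon(a)\varepsilon(b).$$ It is a dual quasi-Hopf algebra if, moreover, there are a linear antimorphism of coalgebras $S:A\to A$ (that is, $\Delta(S(a))=\sum S(a_2)\otimes S(a_1)$ and $\varepsilon\circ S=\varepsilon$; $S$ is not required to be bijective) and $\alpha,\beta\in A^*$ such that for all $a\in A$ $$\sum S(a_1)\,\alpha(a_2)\,a_3=\alpha(a)1,\qquad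 \sum a_1\,\beta(a_2)\,S(a_3)=\beta(a)1,$$ $$\sum\varphi\bigl(a_1\beta(a_2),S(a_3),\alpha(a_4)a_5\bigr)=\sum\varphi^{-1}\bigl(S(a_1),\alpha(a_2)a_3,\beta(a_4)S(a_5)\bigr)=\varepsilon(a).$$ Give $A^*$ the convolution product. A left (respectively right) integral on $A$ is a $T\in A^*$ such that $a^*T=a^*(1)T$ (respectively $Ta^*=a^*(1)T$) for all $a^*\in A^*$; let $\int_l$ and $\int_r$ be the spaces of left and of right integrals on $A$. **Proposition 4.7.** Let $A$ be a dual quasi-Hopf algebra over a field $k$, of arbitrary dimension, that has a nonzero left integral or a nonzero right integral. Then $\dim_k\int_l=\dim_k\int_r=1$. -/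

import Mathlib

open scoped TensorProduct

universe u v

noncomputable section

namespace DualQuasi

section Convolution

variable {k : Type u} {C : Type v} [Field k] [AddCommGroup C] [Module k C] [Coalgebra k C]
variable {M : Type v} [AddCommGroup M] [Module k M]

/-- The map `x ↦ ∑ p(x₁) f(x₂)`, for a linear form `p` and a linear map `f` on a coalgebra. -/
def convL (p : C →ₗ[k] k) (f : C →ₗ[k] M) : C →ₗ[k] M :=
  (TensorProduct.lid k M).toLinearMap ∘ₗ TensorProduct.map p f ∘ₗ Coalgebra.comul

/-- The map `x ↦ ∑ f(x₁) p(x₂)`, for a linear map `f` and a linear form `p` on a coalgebra. -/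
def convR (f : C →ₗ[k] M) (p : C →ₗ[k] k) : C →ₗ[k] M :=
  (TensorProduct.rid k M).toLinearMap ∘ₗ TensorProduct.map f p ∘ₗ Coalgebra.comul

end Convolution

section MultMaps

variable {k : Type u} {A : Type v} [Field k] [AddCommGroup A] [Module k A] [Coalgebra k A]
variable (m : A ⊗[k] A →ₗ[k] A) (φ : A ⊗[k] (A ⊗[k] A) →ₗ[k] k)

/-- `a ⊗ b ⊗ c ↦ a(bc)`. -/
def mulRight : A ⊗[k] (A ⊗[k] A) →ₗ[k] A :=
  m ∘ₗ LinearMap.lTensor A m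

/-- `a ⊗ b ⊗ c ↦ (ab)c`. -/
def mulLeft : A ⊗[k] (A ⊗[k] A) →ₗ[k] A :=
  m ∘ₗ LinearMap.rTensor A m ∘ₗ (TensorProduct.assoc k A A A).symm.toLinearMap

/-- `a ⊗ b ⊗ c ⊗ d ↦ φ(a, b, cd)`. -/
def assocMul34 : A ⊗[k] (A ⊗[k] (A ⊗[k] A)) →ₗ[k] k :=
  φ ∘ₗ LinearMap.lTensor A (LinearMap.lTensor A m)

/-- `a ⊗ b ⊗ c ⊗ d ↦ φ(ab, c, d)`. -/
def assocMul12 : A ⊗[k] (A ⊗[k] (A ⊗[k] A)) →ₗ[k] k :=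
  φ ∘ₗ LinearMap.rTensor (A ⊗[k] A) m ∘ₗ
    (TensorProduct.assoc k A A (A ⊗[k] A)).symm.toLinearMap

/-- `a ⊗ b ⊗ c ⊗ d ↦ φ(a, bc, d)`. -/
def assocMul23 : A ⊗[k] (A ⊗[k] (A ⊗[k] A)) →ₗ[k] k :=
  φ ∘ₗ LinearMap.lTensor A
    (LinearMap.rTensor A m ∘ₗ (TensorProduct.assoc k A A A).symm.toLinearMap)

/-- `a ⊗ b ⊗ c ⊗ d ↦ ε(a) φ(b, c, d)`. -/
def assocEps1 : A ⊗[k] (A ⊗[k] (A ⊗[k] A)) →ₗ[k] k :=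
  (TensorProduct.lid k k).toLinearMap ∘ₗ TensorProduct.map Coalgebra.counit φ

/-- `a ⊗ b ⊗ c ⊗ d ↦ φ(a, b, c) ε(d)`. -/
def assocEps4 : A ⊗[k] (A ⊗[k] (A ⊗[k] A)) →ₗ[k] k :=
  φ ∘ₗ LinearMap.lTensor A (LinearMap.lTensor A
    ((TensorProduct.rid k A).toLinearMap ∘ₗ LinearMap.lTensor A Coalgebra.counit))

end MultMaps

/-- A dual quasi-bialgebra structure on a (coassociative, counital) `k`-coalgebra `A`. -/
structure DualQuasiBialgebra (k : Type u) (A : Type v) [Field k] [AddCommGroup A] [Module k A]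
    [Coalgebra k A] where
  /-- the multiplication, a coalgebra morphism, not assumed to be associative -/
  mul : A ⊗[k] A →ₗc[k] A
  /-- the unit, a coalgebra morphism -/
  unit : k →ₗc[k] A
  /-- the reassociator, an invertible element of the convolution algebra `(A ⊗ A ⊗ A)^*` -/
  reassoc : (WithConv (A ⊗[k] (A ⊗[k] A) →ₗ[k] k))ˣ
  /-- `∑ a₁(b₁c₁) φ(a₂, b₂, c₂) = ∑ φ(a₁, b₁, c₁) (a₂b₂)c₂` -/
  quasi_assoc :
    convR (mulRight mul.toLinearMap) reassoc.val.ofConv =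
      convL reassoc.val.ofConv (mulLeft mul.toLinearMap)
  one_mul : ∀ a : A, mul (unit 1 ⊗ₜ[k] a) = a
  mul_one : ∀ a : A, mul (a ⊗ₜ[k] unit 1) = a
  /-- `∑ φ(a₁, b₁, c₁d₁) φ(a₂b₂, c₂, d₂) = ∑ φ(b₁, c₁, d₁) φ(a₁, b₂c₂, d₂) φ(a₂, b₃, c₃)`,
  as an identity of convolution products on `A ⊗ A ⊗ A ⊗ A` -/
  cocycle :
    WithConv.toConv (assocMul34 mul.toLinearMap reassoc.val.ofConv) *
        WithConv.toConv (assocMul12 mul.toLinearMap reassoc.val.ofConv) =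
      WithConv.toConv (assocEps1 reassoc.val.ofConv) *
          WithConv.toConv (assocMul23 mul.toLinearMap reassoc.val.ofConv) *
        WithConv.toConv (assocEps4 reassoc.val.ofConv)
  /-- `φ(a, 1, b) = ε(a) ε(b)` -/
  reassoc_one : ∀ a b : A,
    reassoc.val.ofConv (a ⊗ₜ[k] (unit 1 ⊗ₜ[k] b)) =
      Coalgebra.counit (R := k) a * Coalgebra.counit (R := k) b

/-- A dual quasi-Hopf algebra structure on a `k`-coalgebra `A`. The antipode is not assumed to be
bijective. -/
structure DualQuasiHopfAlgebra (k : Type u) (A : Type v) [Field k] [AddCommGroup A] [Module k A]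
    [Coalgebra k A] extends DualQuasiBialgebra k A where
  /-- the antipode, an antimorphism of coalgebras -/
  antipode : A →ₗ[k] A
  alpha : A →ₗ[k] k
  beta : A →ₗ[k] k
  comul_antipode :
    Coalgebra.comul ∘ₗ antipode =
      TensorProduct.map antipode antipode ∘ₗ
        (TensorProduct.comm k A A).toLinearMap ∘ₗ Coalgebra.comul
  counit_antipode : Coalgebra.counit (R := k) ∘ₗ antipode = Coalgebra.counit
  /-- `∑ S(a₁) α(a₂) a₃ = α(a) 1` -/
  antipode_alpha : ∀ a : A,
    mul (TensorProduct.map antipode (convL alpha LinearMap.id) (Coalgebra.comul a)) =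
      alpha a • unit 1
  /-- `∑ a₁ β(a₂) S(a₃) = β(a) 1` -/
  beta_antipode : ∀ a : A,
    mul (TensorProduct.map (convR LinearMap.id beta) antipode (Coalgebra.comul a)) =
      beta a • unit 1
  /-- `∑ φ(a₁ β(a₂), S(a₃), α(a₄) a₅) = ε(a)` -/
  reassoc_antipode :
    reassoc.val.ofConv ∘ₗ
        TensorProduct.map (convR LinearMap.id beta)
          (TensorProduct.map antipode (convL alpha LinearMap.id) ∘ₗ Coalgebra.comul) ∘ₗ
        Coalgebra.comul = Coalgebra.counit
  /-- `∑ φ⁻¹(S(a₁), α(a₂) a₃, β(a₄) S(a₅)) = ε(a)` -/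
  reassoc_inv_antipode :
    (reassoc⁻¹).val.ofConv ∘ₗ
        TensorProduct.map antipode
          (TensorProduct.map (convL alpha LinearMap.id) (convL beta antipode) ∘ₗ
            Coalgebra.comul) ∘ₗ
        Coalgebra.comul = Coalgebra.counit

namespace DualQuasiBialgebra

variable {k : Type u} {A : Type v} [Field k] [AddCommGroup A] [Module k A] [Coalgebra k A]

/-- The space of left integrals on `A`: the `T ∈ A^*` with `f T = f(1) T` for all `f ∈ A^*`, the
product on `A^*` being convolution. -/
def leftIntegrals (H : DualQuasiBialgebra k A) : Submodule k (A →ₗ[k] k) where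
  carrier := {T | ∀ f : A →ₗ[k] k,
    WithConv.toConv f * WithConv.toConv T = f (H.unit 1) • WithConv.toConv T}
  zero_mem' := fun f => by simp
  add_mem' := fun {S T} hS hT f => by
    rw [WithConv.toConv_add, mul_add, hS f, hT f, smul_add]
  smul_mem' := fun c T hT f => by
    rw [WithConv.toConv_smul, mul_smul_comm, hT f, smul_comm]

/-- The space of right integrals on `A`: the left integrals on `A^{op,cop}`. The convolution
product of `f` and `T` on `A^{op,cop}` is the convolution product `T f` on `A`, and the unit of
`A^{op,cop}` is that of `A`, so these are the `T ∈ A^*` with `T f = f(1) T` for all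
`f ∈ A^*`. -/
def rightIntegrals (H : DualQuasiBialgebra k A) : Submodule k (A →ₗ[k] k) where
  carrier := {T | ∀ f : A →ₗ[k] k,
    WithConv.toConv T * WithConv.toConv f = f (H.unit 1) • WithConv.toConv T}
  zero_mem' := fun f => by simp
  add_mem' := fun {S T} hS hT f => by
    rw [WithConv.toConv_add, add_mul, hS f, hT f, smul_add]
  smul_mem' := fun c T hT f => by
    rw [WithConv.toConv_smul, smul_mul_assoc, hT f, smul_comm]

end DualQuasiBialgebra

end DualQuasi

end

/-!
# Uniqueness of integrals on a dual quasi-Hopf algebra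

Write `R_n` for the convolution algebra of linear forms on the `n`-fold tensor power of `A`, `φ`
for the reassociator and `ψ` for its inverse. Every formula involving the antipode is obtained by
composing an identity in some `R_n` with one of the two "contractions"
`y ↦ S(y₁) ⊗ α(y₂) y₃` and `x ↦ x₁ β(x₂) ⊗ S(x₃)`. They are not coalgebra maps, but they are
colinear on each side in the sense of `LCompat` and `RCompat`, which is what allows a factor of a
convolution product to be pulled out of a contraction.

*Existence on both sides.* Let `λ` be a left integral. From `φ` and `λ` one builds a form `q` on
`A ⊗ A` with `∑ h(x₁) q(x₂, a) = ∑ q(x, a₁) h(a₂)` for all `h` (`Core.twist_balanced`), then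
`t(n, a) = ∑ q(n, a₁) α(a₂)`, which satisfies `t * h(S(n) a) = h(1) t` on `A^cop ⊗ A`
(`Core.twistAlpha_mul`). Contracting the product of `t(n, y a)` and `φ(S(n), y, a)` over the first
two variables gives a family of right integrals indexed by `n`
(`Core.isRightInt_rightIntFamily`). The identity `∑ φ(a₁ β(a₂), S(a₃), α(a₄) a₅) = ε(a)` shows
that the family determines `t(n, 1) = α(1)² λ(n)`, so it is nonzero if `λ` is. This uses neither
the cocycle identity nor `ψ`, and the data it does use, collected in the structure `Core`, are
stable under passing to the opposite-co-opposite structure (`Core.opCop`), which exchanges left and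
right integrals. Hence a nonzero integral on one side yields one on the other.

*Uniqueness.* Put `χ(z, a) = ∑ ψ(S(z₁), α(z₂) z₃, a)`. Contracting the cocycle identity over two
overlapping pairs of variables yields
`∑ (χ(x, y a) * φ(x, y, a))(x₁ β(x₂) ⊗ S(x₃) ⊗ a) = ε(x) ε(a)`
(`DualQuasiHopfAlgebra.pull_betaTens_χ`). For a right integral `T` put `t = χ * T(y a)` and let
`B(x, a)` be the contraction of `ε(x) t(y, a) * φ(x, y, a)`. Then
`∑ h(x₁) B(x₂, a) = ∑ B(x, a₁) h(a₂)` for all `h`, and `∑ α(x₁) B(x₂, a) = t(S(x), a)`, while the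
contraction of `t(x, y a) * φ(x, y, a)` is `ε(x) T(a)`. If `λ` is a left integral, `λ(x) ≠ 0` and
`B(x, 1) = 0`, then `y = ∑ λ(x₁) x₂` satisfies `B(y, ·) = 0`; expanding `Δ(y)` along a basis shows
that `t` vanishes on all the second tensor factors of `Δ(y)` after applying `S`, which forces
`0 = ε(y) T = λ(x) T`, so `T = 0` (`DualQuasiHopfAlgebra.pairing_ne_zero`). So for fixed `x` with
`λ(x) ≠ 0` the map `T ↦ B(x, 1)` is injective on right integrals, and for fixed `T ≠ 0` the form
`B(·, 1)` has its kernel inside the kernel of every left integral; both spaces have dimension at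
most one.
-/

open TensorProduct Coalgebra WithConv

set_option linter.unusedSectionVars false

noncomputable section

namespace DualQuasi

/-! ### Functionals on coalgebras and contractions -/

section Framework

variable {k : Type*} [Field k]
variable {C D E P Q F : Type*}
  [AddCommGroup C] [Module k C] [Coalgebra k C]
  [AddCommGroup D] [Module k D] [Coalgebra k D]
  [AddCommGroup E] [Module k E] [Coalgebra k E]
  [AddCommGroup F] [Module k F] [Coalgebra k F]
  [AddCommGroup P] [Module k P] [Coalgebra k P]
  [AddCommGroup Q] [Module k Q] [Coalgebra k Q]

/-- Composition of a linear form with a linear map, on the convolution algebras of linear forms. -/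
def pull (f : P →ₗ[k] Q) (X : WithConv (Q →ₗ[k] k)) : WithConv (P →ₗ[k] k) :=
  toConv (X.ofConv ∘ₗ f)

@[simp] lemma pull_apply (f : P →ₗ[k] Q) (X : WithConv (Q →ₗ[k] k)) (p : P) :
    pull f X p = X (f p) := rfl

lemma pull_pull (f : P →ₗ[k] Q) (g : Q →ₗ[k] E) (X : WithConv (E →ₗ[k] k)) :
    pull f (pull g X) = pull (g ∘ₗ f) X := rfl

lemma pull_add (f : P →ₗ[k] Q) (X Y : WithConv (Q →ₗ[k] k)) :
    pull f (X + Y) = pull f X + pull f Y := rfl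

lemma pull_smul (f : P →ₗ[k] Q) (c : k) (X : WithConv (Q →ₗ[k] k)) :
    pull f (c • X) = c • pull f X := rfl

lemma pull_zero (f : P →ₗ[k] Q) : pull f (0 : WithConv (Q →ₗ[k] k)) = 0 := rfl

lemma convMul_eq (X Y : WithConv (C →ₗ[k] k)) :
    X * Y = toConv (LinearMap.mul' k k ∘ₗ map X.ofConv Y.ofConv ∘ₗ comul) := rfl

/-- An unbundled version of `CoalgHom`, for use with composites of plain linear maps. -/
structure IsCoalgHom (f : P →ₗ[k] Q) : Prop where
  counit_comp : counit (R := k) ∘ₗ f = counit (R := k)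
  comul_comp : comul ∘ₗ f = map f f ∘ₗ comul

lemma isCoalgHom (f : P →ₗc[k] Q) : IsCoalgHom f.toLinearMap :=
  ⟨f.counit_comp, f.map_comp_comul.symm⟩

lemma IsCoalgHom.id : IsCoalgHom (LinearMap.id : P →ₗ[k] P) := ⟨rfl, by simp⟩

lemma IsCoalgHom.comp {g : Q →ₗ[k] E} {f : P →ₗ[k] Q} (hg : IsCoalgHom g) (hf : IsCoalgHom f) :
    IsCoalgHom (g ∘ₗ f) where
  counit_comp := by rw [← LinearMap.comp_assoc, hg.counit_comp, hf.counit_comp]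
  comul_comp := by
    rw [← LinearMap.comp_assoc, hg.comul_comp, LinearMap.comp_assoc, hf.comul_comp,
      ← LinearMap.comp_assoc, ← map_comp]

lemma IsCoalgHom.map {f : C →ₗ[k] D} {g : P →ₗ[k] Q} (hf : IsCoalgHom f) (hg : IsCoalgHom g) :
    IsCoalgHom (TensorProduct.map f g) :=
  isCoalgHom (Coalgebra.TensorProduct.map (R := k) (S := k)
    ⟨f, hf.counit_comp, hf.comul_comp.symm⟩ ⟨g, hg.counit_comp, hg.comul_comp.symm⟩)

lemma isCoalgHom_assoc : IsCoalgHom (TensorProduct.assoc k C D E).toLinearMap :=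
  isCoalgHom (Coalgebra.TensorProduct.assoc k k C D E).toCoalgHom

lemma isCoalgHom_assoc_symm : IsCoalgHom (TensorProduct.assoc k C D E).symm.toLinearMap :=
  isCoalgHom (Coalgebra.TensorProduct.assoc k k C D E).symm.toCoalgHom

lemma isCoalgHom_counit : IsCoalgHom (counit : C →ₗ[k] k) where
  counit_comp := by ext; simp
  comul_comp := by
    ext c
    have := congr(LinearMap.lTensor k (counit (R := k)) $(rTensor_counit_comul (R := k) c))
    simp only [LinearMap.comp_apply, CommSemiring.comul_apply]
    rw [← LinearMap.comp_apply, LinearMap.lTensor_comp_rTensor] at this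
    rw [this, LinearMap.lTensor_tmul]

variable (k C D) in
/-- The projection `c ⊗ d ↦ ε(d) c`. -/
def fstC : C ⊗[k] D →ₗ[k] C := (TensorProduct.rid k C).toLinearMap ∘ₗ LinearMap.lTensor C counit

variable (k C D) in
/-- The projection `c ⊗ d ↦ ε(c) d`. -/
def sndC : C ⊗[k] D →ₗ[k] D := (TensorProduct.lid k D).toLinearMap ∘ₗ LinearMap.rTensor D counit

@[simp] lemma fstC_tmul (c : C) (d : D) :
    fstC k C D (c ⊗ₜ d) = counit (R := k) d • c := by simp [fstC]

@[simp] lemma sndC_tmul (c : C) (d : D) :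
    sndC k C D (c ⊗ₜ d) = counit (R := k) c • d := by simp [sndC]

lemma isCoalgHom_fstC : IsCoalgHom (fstC k C D) :=
  (isCoalgHom (Coalgebra.TensorProduct.rid k k C).toCoalgHom).comp
    (IsCoalgHom.id.map isCoalgHom_counit)
lemma pull_mul {f : P →ₗ[k] Q} (hf : IsCoalgHom f) (X Y : WithConv (Q →ₗ[k] k)) :
    pull f (X * Y) = pull f X * pull f Y := by
  simp only [convMul_eq, pull, LinearMap.comp_assoc, hf.comul_comp]
  rw [← LinearMap.comp_assoc (comul), ← map_comp]

lemma pull_one {f : P →ₗ[k] Q} (hf : IsCoalgHom f) :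
    pull f (1 : WithConv (Q →ₗ[k] k)) = 1 := by
  ext p
  exact congr($(hf.counit_comp) p)

/-- `κ` intertwines the left coactions of `E` on `Q` along `f` and on `P` along `g`:
`∑ f(κ(p)₁) ⊗ κ(p)₂ = ∑ g(p₁) ⊗ κ(p₂)`. The maps `f`, `g`, `κ` need not be coalgebra maps. -/
def LCompat (κ : P →ₗ[k] Q) (f : Q →ₗ[k] E) (g : P →ₗ[k] E) : Prop :=
  map f LinearMap.id ∘ₗ comul ∘ₗ κ = map g κ ∘ₗ comul

/-- `κ` intertwines the right coactions of `E` on `Q` along `f` and on `P` along `g`: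
`∑ κ(p)₁ ⊗ f(κ(p)₂) = ∑ κ(p₁) ⊗ g(p₂)`. -/
def RCompat (κ : P →ₗ[k] Q) (f : Q →ₗ[k] E) (g : P →ₗ[k] E) : Prop :=
  map LinearMap.id f ∘ₗ comul ∘ₗ κ = map κ g ∘ₗ comul

/-- A left factor of a convolution product can be taken out of a left colinear contraction. -/
lemma LCompat.pull_mul {κ : P →ₗ[k] Q} {f : Q →ₗ[k] E} {g : P →ₗ[k] E} (h : LCompat κ f g)
    (X : WithConv (E →ₗ[k] k)) (Y : WithConv (Q →ₗ[k] k)) :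
    pull κ (pull f X * Y) = pull g X * pull κ Y := by
  have := congr(LinearMap.mul' k k ∘ₗ map X.ofConv Y.ofConv ∘ₗ $h)
  simp only [convMul_eq, pull, LinearMap.comp_assoc, ofConv_toConv]
  simp only [← LinearMap.comp_assoc, ← map_comp, LinearMap.comp_id] at this ⊢
  simp only [LinearMap.comp_assoc] at this ⊢
  simp [← this]

/-- A right factor of a convolution product can be taken out of a right colinear contraction. -/
lemma RCompat.pull_mul {κ : P →ₗ[k] Q} {f : Q →ₗ[k] E} {g : P →ₗ[k] E} (h : RCompat κ f g)
    (X : WithConv (Q →ₗ[k] k)) (Y : WithConv (E →ₗ[k] k)) :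
    pull κ (X * pull f Y) = pull κ X * pull g Y := by
  have := congr(LinearMap.mul' k k ∘ₗ map X.ofConv Y.ofConv ∘ₗ $h)
  simp only [convMul_eq, pull, LinearMap.comp_assoc, ofConv_toConv]
  simp only [← LinearMap.comp_assoc, ← map_comp, LinearMap.comp_id] at this ⊢
  simp only [LinearMap.comp_assoc] at this ⊢
  simp [← this]

lemma LCompat.postcomp {κ : P →ₗ[k] Q} {f : Q →ₗ[k] E} {g : P →ₗ[k] E} (h : LCompat κ f g)
    (e : E →ₗ[k] F) : LCompat κ (e ∘ₗ f) (e ∘ₗ g) := by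
  have := congr(map e LinearMap.id ∘ₗ $h)
  simpa only [LCompat, ← LinearMap.comp_assoc, ← map_comp, LinearMap.id_comp] using this

lemma RCompat.postcomp {κ : P →ₗ[k] Q} {f : Q →ₗ[k] E} {g : P →ₗ[k] E} (h : RCompat κ f g)
    (e : E →ₗ[k] F) : RCompat κ (e ∘ₗ f) (e ∘ₗ g) := by
  have := congr(map LinearMap.id e ∘ₗ $h)
  simpa only [RCompat, ← LinearMap.comp_assoc, ← map_comp, LinearMap.id_comp] using this

lemma LCompat.comp_hom {κ : P →ₗ[k] Q} {e : Q →ₗ[k] F} {f : F →ₗ[k] E} {g : P →ₗ[k] E}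
    (h : LCompat κ (f ∘ₗ e) g) (he : IsCoalgHom e) : LCompat (e ∘ₗ κ) f g := by
  have := congr(map LinearMap.id e ∘ₗ $h)
  simp only [LCompat, ← LinearMap.comp_assoc, he.comul_comp] at this ⊢
  simpa only [← map_comp, LinearMap.id_comp, LinearMap.comp_id] using this

lemma RCompat.comp_hom {κ : P →ₗ[k] Q} {e : Q →ₗ[k] F} {f : F →ₗ[k] E} {g : P →ₗ[k] E}
    (h : RCompat κ (f ∘ₗ e) g) (he : IsCoalgHom e) : RCompat (e ∘ₗ κ) f g := by
  have := congr(map e LinearMap.id ∘ₗ $h)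
  simp only [RCompat, ← LinearMap.comp_assoc, he.comul_comp] at this ⊢
  simpa only [← map_comp, LinearMap.id_comp, LinearMap.comp_id] using this

lemma comul_tensor : (comul : C ⊗[k] D →ₗ[k] _) =
    (tensorTensorTensorComm k C C D D).toLinearMap ∘ₗ map comul comul := rfl

lemma ttc_map {A₁ A₂ A₃ A₄ B₁ B₂ B₃ B₄ : Type*} [AddCommGroup A₁] [Module k A₁]
    [AddCommGroup A₂] [Module k A₂] [AddCommGroup A₃] [Module k A₃] [AddCommGroup A₄] [Module k A₄]
    [AddCommGroup B₁] [Module k B₁]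
    [AddCommGroup B₂] [Module k B₂] [AddCommGroup B₃] [Module k B₃] [AddCommGroup B₄] [Module k B₄]
    (f₁ : A₁ →ₗ[k] B₁) (f₂ : A₂ →ₗ[k] B₂) (f₃ : A₃ →ₗ[k] B₃) (f₄ : A₄ →ₗ[k] B₄) :
    map (map f₁ f₃) (map f₂ f₄) ∘ₗ (tensorTensorTensorComm k A₁ A₂ A₃ A₄).toLinearMap =
    (tensorTensorTensorComm k B₁ B₂ B₃ B₄).toLinearMap ∘ₗ map (map f₁ f₂) (map f₃ f₄) := by
  ext; simp

lemma LCompat.map {κ : P →ₗ[k] Q} {f : Q →ₗ[k] E} {g : P →ₗ[k] E} (h : LCompat κ f g)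
    {P' Q' E' : Type*} [AddCommGroup P'] [Module k P'] [Coalgebra k P']
    [AddCommGroup Q'] [Module k Q'] [Coalgebra k Q']
    [AddCommGroup E'] [Module k E'] [Coalgebra k E']
    {κ' : P' →ₗ[k] Q'} {f' : Q' →ₗ[k] E'} {g' : P' →ₗ[k] E'} (h' : LCompat κ' f' g') :
    LCompat (map κ κ') (map f f') (map g g') := by
  have := congr((tensorTensorTensorComm k E Q E' Q').toLinearMap ∘ₗ TensorProduct.map $h $h')
  simp only [map_comp, ← LinearMap.comp_assoc, ← ttc_map] at this
  simp only [LCompat, comul_tensor, ← LinearMap.comp_assoc, ← this, map_id]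

lemma RCompat.map {κ : P →ₗ[k] Q} {f : Q →ₗ[k] E} {g : P →ₗ[k] E} (h : RCompat κ f g)
    {P' Q' E' : Type*} [AddCommGroup P'] [Module k P'] [Coalgebra k P']
    [AddCommGroup Q'] [Module k Q'] [Coalgebra k Q']
    [AddCommGroup E'] [Module k E'] [Coalgebra k E']
    {κ' : P' →ₗ[k] Q'} {f' : Q' →ₗ[k] E'} {g' : P' →ₗ[k] E'} (h' : RCompat κ' f' g') :
    RCompat (map κ κ') (map f f') (map g g') := by
  have := congr((tensorTensorTensorComm k Q E Q' E').toLinearMap ∘ₗ TensorProduct.map $h $h')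
  simp only [map_comp, ← LinearMap.comp_assoc, ← ttc_map] at this
  simp only [RCompat, comul_tensor, ← LinearMap.comp_assoc, ← this, map_id]

lemma LCompat.of_hom {κ : P →ₗ[k] Q} (hκ : IsCoalgHom κ) (f : Q →ₗ[k] E) :
    LCompat κ f (f ∘ₗ κ) := by
  rw [LCompat, hκ.comul_comp, ← LinearMap.comp_assoc, ← map_comp, LinearMap.id_comp]

lemma RCompat.of_hom {κ : P →ₗ[k] Q} (hκ : IsCoalgHom κ) (f : Q →ₗ[k] E) :
    RCompat κ f (f ∘ₗ κ) := by
  rw [RCompat, hκ.comul_comp, ← LinearMap.comp_assoc, ← map_comp, LinearMap.id_comp]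

end Framework

/-! ### The co-opposite coalgebra -/

section Cop

variable {k : Type*} [Field k]
variable {C D E F : Type*}
  [AddCommGroup C] [Module k C] [Coalgebra k C]
  [AddCommGroup D] [Module k D] [Coalgebra k D]
  [AddCommGroup E] [Module k E] [Coalgebra k E]
  [AddCommGroup F] [Module k F] [Coalgebra k F]

/-- The co-opposite coalgebra: a type synonym of `C`, with the comultiplication flipped. -/
def Cop (C : Type*) : Type _ := C

instance : AddCommGroup (Cop C) := inferInstanceAs (AddCommGroup C)
instance : Module k (Cop C) := inferInstanceAs (Module k C)

variable (k C) in
/-- The identity map from a coalgebra to its co-opposite. -/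
def cop : C ≃ₗ[k] Cop C := LinearEquiv.refl k C

lemma comul_comm_coassoc :
    (TensorProduct.assoc k C C C).toLinearMap ∘ₗ
      LinearMap.rTensor C ((TensorProduct.comm k C C).toLinearMap ∘ₗ comul) ∘ₗ
        (TensorProduct.comm k C C).toLinearMap ∘ₗ comul =
    LinearMap.lTensor C ((TensorProduct.comm k C C).toLinearMap ∘ₗ comul) ∘ₗ
        (TensorProduct.comm k C C).toLinearMap ∘ₗ comul := by
  let F := (TensorProduct.assoc k C C C).toLinearMap ∘ₗ
    (TensorProduct.comm k C (C ⊗[k] C)).toLinearMap ∘ₗ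
      LinearMap.lTensor C (TensorProduct.comm k C C).toLinearMap
  have h1 : (TensorProduct.assoc k C C C).toLinearMap ∘ₗ
      LinearMap.rTensor C ((TensorProduct.comm k C C).toLinearMap ∘ₗ comul) ∘ₗ
        (TensorProduct.comm k C C).toLinearMap = F ∘ₗ LinearMap.lTensor C comul := by
    ext u v
    simp [F]
  have h2 : LinearMap.lTensor C ((TensorProduct.comm k C C).toLinearMap ∘ₗ comul) ∘ₗ
        (TensorProduct.comm k C C).toLinearMap =
      F ∘ₗ (TensorProduct.assoc k C C C).toLinearMap ∘ₗ LinearMap.rTensor C comul := by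
    refine TensorProduct.ext' fun u v => ?_
    simp only [F, LinearMap.comp_apply, LinearEquiv.coe_coe, comm_tmul, LinearMap.lTensor_tmul,
      LinearMap.rTensor_tmul]
    induction (comul u : C ⊗[k] C) with
    | zero => simp
    | add x y hx hy => simp only [map_add, tmul_add, add_tmul, hx, hy]
    | tmul x y => simp
  refine (congr($h1 ∘ₗ comul)).trans (Eq.trans ?_ (congr($h2 ∘ₗ comul)).symm)
  exact congr(F ∘ₗ $((Coalgebra.coassoc (R := k) (A := C)).symm))

instance : CoalgebraStruct k (Cop C) where
  comul := map (cop k C).toLinearMap (cop k C).toLinearMap ∘ₗ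
    (TensorProduct.comm k C C).toLinearMap ∘ₗ comul ∘ₗ (cop k C).symm.toLinearMap
  counit := counit ∘ₗ (cop k C).symm.toLinearMap

lemma comul_cop_eq : (comul : Cop C →ₗ[k] Cop C ⊗[k] Cop C) =
    ((TensorProduct.comm k C C).toLinearMap ∘ₗ comul : C →ₗ[k] C ⊗[k] C) := by
  have : map (cop k C).toLinearMap (cop k C).toLinearMap = LinearMap.id := map_id
  refine Eq.trans (b := map (cop k C).toLinearMap (cop k C).toLinearMap ∘ₗ
    (TensorProduct.comm k C C).toLinearMap ∘ₗ comul) rfl ?_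
  rw [this]
  rfl

instance : Coalgebra k (Cop C) where
  coassoc := by
    rw [comul_cop_eq (k := k) (C := C)]
    have := comul_comm_coassoc (k := k) (C := C)
    exact this
  rTensor_counit_comp_comul := by
    rw [comul_cop_eq (k := k) (C := C)]
    refine LinearMap.ext fun (c : C) => ?_
    have := congr(TensorProduct.comm k C k $(lTensor_counit_comul (R := k) c))
    rw [comm_tmul] at this
    exact Eq.trans (LinearMap.congr_fun (LinearMap.rTensor_comp_comm (N := C)
      (counit (R := k) (A := C))) (comul c)) this
  lTensor_counit_comp_comul := by
    rw [comul_cop_eq (k := k) (C := C)]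
    refine LinearMap.ext fun (c : C) => ?_
    have := congr(TensorProduct.comm k k C $(rTensor_counit_comul (R := k) c))
    rw [comm_tmul] at this
    exact Eq.trans (LinearMap.congr_fun (LinearMap.lTensor_comp_comm (M := C)
      (counit (R := k) (A := C))) (comul c)) this

lemma comul_cop (n : C) : comul (R := k) (cop k C n) =
    map (cop k C).toLinearMap (cop k C).toLinearMap (TensorProduct.comm k C C (comul n)) := rfl

lemma counit_cop (n : C) : counit (R := k) (cop k C n) = counit (R := k) n := rfl

/-- An antimorphism of coalgebras. -/
structure IsAntiCoalgHom (f : C →ₗ[k] D) : Prop where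
  counit_comp : counit (R := k) ∘ₗ f = counit (R := k)
  comul_comp : comul ∘ₗ f = map f f ∘ₗ (TensorProduct.comm k C C).toLinearMap ∘ₗ comul

lemma isAntiCoalgHom_cop : IsAntiCoalgHom (cop k C).toLinearMap where
  counit_comp := by
    ext; rfl
  comul_comp := by
    ext; rfl

lemma isAntiCoalgHom_cop_symm : IsAntiCoalgHom (cop k C).symm.toLinearMap where
  counit_comp := by
    ext; rfl
  comul_comp := by
    ext c
    obtain ⟨c, rfl⟩ := (cop k C).surjective c
    have : comul (R := k) (cop k C c) = map (cop k C).toLinearMap (cop k C).toLinearMap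
      (TensorProduct.comm k C C (comul c)) := rfl
    simp only [LinearMap.comp_apply, LinearEquiv.coe_coe, LinearEquiv.symm_apply_apply, this]
    generalize comul (R := k) c = x
    induction x with
    | zero => simp
    | add x y hx hy => simp only [map_add, ← hx, ← hy]
    | tmul x y => simp

lemma comm_map {A B : Type*} [AddCommGroup A] [Module k A] [AddCommGroup B] [Module k B]
  (f : C →ₗ[k] A) (g : D →ₗ[k] B) : (TensorProduct.comm k A B).toLinearMap ∘ₗ map f g =
    map g f ∘ₗ (TensorProduct.comm k C D).toLinearMap := by ext; simp

lemma IsAntiCoalgHom.comp_hom {g : D →ₗ[k] E} {f : C →ₗ[k] D} (hg : IsAntiCoalgHom g)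
    (hf : IsCoalgHom f) : IsAntiCoalgHom (g ∘ₗ f) where
  counit_comp := by rw [← LinearMap.comp_assoc, hg.counit_comp, hf.counit_comp]
  comul_comp := by
    rw [← LinearMap.comp_assoc, hg.comul_comp, LinearMap.comp_assoc, LinearMap.comp_assoc,
      hf.comul_comp, ← LinearMap.comp_assoc comul, comm_map, map_comp]
    simp only [LinearMap.comp_assoc]

lemma IsCoalgHom.comp_anti {g : D →ₗ[k] E} {f : C →ₗ[k] D} (hg : IsCoalgHom g)
    (hf : IsAntiCoalgHom f) : IsAntiCoalgHom (g ∘ₗ f) where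
  counit_comp := by rw [← LinearMap.comp_assoc, hg.counit_comp, hf.counit_comp]
  comul_comp := by
    rw [← LinearMap.comp_assoc, hg.comul_comp, LinearMap.comp_assoc, hf.comul_comp, map_comp]
    simp only [LinearMap.comp_assoc]

lemma IsAntiCoalgHom.comp {g : D →ₗ[k] E} {f : C →ₗ[k] D} (hg : IsAntiCoalgHom g)
    (hf : IsAntiCoalgHom f) : IsCoalgHom (g ∘ₗ f) where
  counit_comp := by rw [← LinearMap.comp_assoc, hg.counit_comp, hf.counit_comp]
  comul_comp := by
    rw [← LinearMap.comp_assoc, hg.comul_comp, LinearMap.comp_assoc, LinearMap.comp_assoc,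
      hf.comul_comp, ← LinearMap.comp_assoc _ (map f f), comm_map, map_comp]
    simp only [LinearMap.comp_assoc]
    congr 2
    ext
    simp

lemma IsAntiCoalgHom.map {f : C →ₗ[k] D} {g : E →ₗ[k] F} (hf : IsAntiCoalgHom f)
    (hg : IsAntiCoalgHom g) : IsAntiCoalgHom (map f g) where
  counit_comp := by
    have := congr((TensorProduct.rid k k).toLinearMap ∘ₗ
      TensorProduct.map $hf.counit_comp $hg.counit_comp)
    rw [map_comp] at this
    exact this
  comul_comp := by
    have := congr((tensorTensorTensorComm k D D F F).toLinearMap ∘ₗ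
      TensorProduct.map $hf.comul_comp $hg.comul_comp)
    simp only [map_comp, ← LinearMap.comp_assoc, ← ttc_map] at this
    simp only [comul_tensor, ← LinearMap.comp_assoc, this]
    congr 1
    simp only [LinearMap.comp_assoc]
    congr 1
    ext
    simp

lemma isCoalgHom_comm : IsCoalgHom (TensorProduct.comm k C D).toLinearMap where
  counit_comp := by
    ext; simp [mul_comm]
  comul_comp := by
    rw [comul_tensor, comul_tensor, LinearMap.comp_assoc, ← comm_map, ← LinearMap.comp_assoc,
      ← LinearMap.comp_assoc]
    congr 1
    ext; simp

/-- Composition with a coalgebra antimorphism reverses convolution products. -/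
lemma pull_mul_anti {f : C →ₗ[k] D} (hf : IsAntiCoalgHom f) (X Y : WithConv (D →ₗ[k] k)) :
    pull f (X * Y) = pull f Y * pull f X := by
  have : (LinearMap.mul' k k) ∘ₗ (TensorProduct.comm k k k).toLinearMap = LinearMap.mul' k k := by
    ext; simp
  simp only [convMul_eq, pull, LinearMap.comp_assoc, hf.comul_comp, ofConv_toConv]
  rw [← LinearMap.comp_assoc _ (TensorProduct.map f f), ← map_comp,
    ← LinearMap.comp_assoc comul (TensorProduct.comm k C C).toLinearMap, ← comm_map,
    ← LinearMap.comp_assoc, ← LinearMap.comp_assoc, this, LinearMap.comp_assoc]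

end Cop

/-! ### Counit and coassociativity identities -/

section Contractions

variable {k : Type u} [Field k]
variable {C D : Type*} {A : Type v}
  [AddCommGroup C] [Module k C] [Coalgebra k C]
  [AddCommGroup D] [Module k D] [Coalgebra k D]
  [AddCommGroup A] [Module k A] [Coalgebra k A]

@[simp] lemma counit_smul_comul_left (d : D) :
    TensorProduct.lid k D (map counit LinearMap.id (comul d)) = d := by
  have := rTensor_counit_comul (R := k) d
  rw [LinearMap.rTensor] at this
  simp [this]

@[simp] lemma counit_smul_comul_right (d : D) :
    TensorProduct.rid k D (map LinearMap.id counit (comul d)) = d := by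
  have := lTensor_counit_comul (R := k) d
  rw [LinearMap.lTensor] at this
  simp [this]

lemma map_id_sndC_comp_comul : map LinearMap.id (sndC k C D) ∘ₗ comul =
    (TensorProduct.assoc k C D D).symm.toLinearMap ∘ₗ map LinearMap.id comul := by
  refine TensorProduct.ext' fun c d => ?_
  conv_rhs => rw [← counit_smul_comul_right (k := k) c]
  simp only [LinearMap.comp_apply, comul_tmul, LinearEquiv.coe_coe, map_tmul, LinearMap.id_apply]
  induction (comul c : C ⊗[k] C) with
  | zero => simp
  | add x y hx hy => simp only [map_add, add_tmul, hx, hy]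
  | tmul x y =>
    induction (comul d : D ⊗[k] D) with
    | zero => simp
    | add x y hx hy => simp only [map_add, tmul_add, hx, hy]
    | tmul x y => simp [smul_tmul]

lemma map_fstC_id_comp_comul : map (fstC k C D) LinearMap.id ∘ₗ comul =
    (TensorProduct.assoc k C C D).toLinearMap ∘ₗ map comul LinearMap.id := by
  refine TensorProduct.ext' fun c d => ?_
  conv_rhs => rw [← counit_smul_comul_left (k := k) d]
  simp only [LinearMap.comp_apply, comul_tmul, LinearEquiv.coe_coe, map_tmul, LinearMap.id_apply]
  induction (comul c : C ⊗[k] C) with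
  | zero => simp
  | add x y hx hy => simp only [map_add, add_tmul, hx, hy]
  | tmul x y =>
    induction (comul d : D ⊗[k] D) with
    | zero => simp
    | add x y hx hy => simp only [map_add, tmul_add, hx, hy]
    | tmul x y => simp [smul_tmul]

lemma map_sndC_id_comp_comul : map (sndC k C D) LinearMap.id ∘ₗ comul =
    (TensorProduct.leftComm k C D D).toLinearMap ∘ₗ map LinearMap.id comul := by
  refine TensorProduct.ext' fun c d => ?_
  conv_rhs => rw [← counit_smul_comul_left (k := k) c]
  simp only [LinearMap.comp_apply, comul_tmul, LinearEquiv.coe_coe, map_tmul, LinearMap.id_apply]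
  induction (comul c : C ⊗[k] C) with
  | zero => simp
  | add x y hx hy => simp only [map_add, add_tmul, hx, hy]
  | tmul x y =>
    induction (comul d : D ⊗[k] D) with
    | zero => simp
    | add x y hx hy => simp only [map_add, tmul_add, hx, hy]
    | tmul x y => simp [smul_tmul]

lemma comul_comp_convL (p : A →ₗ[k] k) : comul ∘ₗ convL p LinearMap.id =
    map (convL p LinearMap.id) LinearMap.id ∘ₗ (comul : A →ₗ[k] A ⊗[k] A) := by
  have h1 : comul ∘ₗ convL p LinearMap.id = (TensorProduct.lid k (A ⊗[k] A)).toLinearMap ∘ₗ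
      map p LinearMap.id ∘ₗ map LinearMap.id comul ∘ₗ (comul : A →ₗ[k] A ⊗[k] A) := by
    rw [convL]
    simp only [← LinearMap.comp_assoc]
    congr 1
    ext; simp
  have h2 : map (convL p LinearMap.id) LinearMap.id ∘ₗ (comul : A →ₗ[k] A ⊗[k] A) =
      (TensorProduct.lid k (A ⊗[k] A)).toLinearMap ∘ₗ map p LinearMap.id ∘ₗ
      (TensorProduct.assoc k A A A).toLinearMap ∘ₗ LinearMap.rTensor A comul ∘ₗ comul := by
    rw [convL]
    simp only [← LinearMap.comp_assoc]
    congr 1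
    refine TensorProduct.ext' fun a b => ?_
    simp only [LinearMap.comp_apply, map_tmul, LinearMap.rTensor_tmul, LinearEquiv.coe_coe]
    induction (comul a : A ⊗[k] A) with
    | zero => simp
    | add x y hx hy => simp only [map_add, add_tmul, hx, hy]
    | tmul x y => simp [smul_tmul']
  rw [h1, h2, coassoc]
  rfl

lemma comul_comp_convR (p : A →ₗ[k] k) : comul ∘ₗ convR LinearMap.id p =
    map LinearMap.id (convR LinearMap.id p) ∘ₗ (comul : A →ₗ[k] A ⊗[k] A) := by
  have h1 : comul ∘ₗ convR LinearMap.id p = (TensorProduct.rid k (A ⊗[k] A)).toLinearMap ∘ₗ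
      map LinearMap.id p ∘ₗ map comul LinearMap.id ∘ₗ (comul : A →ₗ[k] A ⊗[k] A) := by
    rw [convR]
    simp only [← LinearMap.comp_assoc]
    congr 1
    ext; simp
  have h2 : map LinearMap.id (convR LinearMap.id p) ∘ₗ (comul : A →ₗ[k] A ⊗[k] A) =
      (TensorProduct.rid k (A ⊗[k] A)).toLinearMap ∘ₗ map LinearMap.id p ∘ₗ
      (TensorProduct.assoc k A A A).symm.toLinearMap ∘ₗ LinearMap.lTensor A comul ∘ₗ comul := by
    rw [convR]
    simp only [← LinearMap.comp_assoc]
    congr 1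
    refine TensorProduct.ext' fun a b => ?_
    simp only [LinearMap.comp_apply, map_tmul, LinearMap.lTensor_tmul, LinearEquiv.coe_coe]
    induction (comul b : A ⊗[k] A) with
    | zero => simp
    | add x y hx hy => simp only [map_add, tmul_add, hx, hy]
    | tmul x y => simp
  rw [h1, h2, coassoc_symm]
  rfl

lemma map_comul_comul_comp_comul : map comul comul ∘ₗ (comul : C →ₗ[k] C ⊗[k] C) =
    (TensorProduct.assoc k C C (C ⊗[k] C)).symm.toLinearMap ∘ₗ
      map LinearMap.id (TensorProduct.assoc k C C C).toLinearMap ∘ₗ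
      map LinearMap.id (map comul LinearMap.id) ∘ₗ map LinearMap.id comul ∘ₗ comul := by
  simp [coassoc_simps]

end Contractions

/-! ### The contractions attached to the antipode -/

section Contractions

variable {k : Type u} [Field k]
variable {C A : Type v}
  [AddCommGroup C] [Module k C] [Coalgebra k C]
  [AddCommGroup A] [Module k A] [Coalgebra k A]

/-- `y ↦ S(y₁) ⊗ α(y₂) y₃` -/
def alphaContr (S : A →ₗ[k] A) (α : A →ₗ[k] k) : A →ₗ[k] A ⊗[k] A :=
  map S (convL α LinearMap.id) ∘ₗ comul

/-- `c ↦ c₁ β(c₂) ⊗ S(c₃)` -/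
def betaContr (S : C →ₗ[k] A) (β : C →ₗ[k] k) : C →ₗ[k] C ⊗[k] A :=
  map (convR LinearMap.id β) S ∘ₗ comul

lemma rCompat_alphaContr (S : A →ₗ[k] A) (α : A →ₗ[k] k) :
    RCompat (alphaContr S α) (sndC k A A) LinearMap.id := by
  rw [RCompat, ← LinearMap.comp_assoc, map_id_sndC_comp_comul, alphaContr, LinearMap.comp_assoc,
    ← LinearMap.comp_assoc comul, ← map_comp, comul_comp_convL, LinearMap.id_comp]
  have : map S (map (convL α LinearMap.id) LinearMap.id ∘ₗ comul) =
      map S (map (convL α LinearMap.id) LinearMap.id) ∘ₗ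
        LinearMap.lTensor A (comul (R := k) (A := A)) := by
    rw [LinearMap.lTensor, ← map_comp, LinearMap.comp_id]
  rw [this, LinearMap.comp_assoc, ← coassoc]
  simp only [← LinearMap.comp_assoc]
  congr 1
  refine TensorProduct.ext' fun a b => ?_
  simp only [LinearMap.comp_apply, map_tmul, LinearMap.rTensor_tmul, LinearEquiv.coe_coe]
  induction (comul a : A ⊗[k] A) with
  | zero => simp
  | add x y hx hy => simp only [map_add, add_tmul, hx, hy]
  | tmul x y => simp

lemma lCompat_betaContr (S : C →ₗ[k] A) (β : C →ₗ[k] k) :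
    LCompat (betaContr S β) (fstC k C A) LinearMap.id := by
  rw [LCompat, ← LinearMap.comp_assoc, map_fstC_id_comp_comul, betaContr, LinearMap.comp_assoc,
    ← LinearMap.comp_assoc comul, ← map_comp, comul_comp_convR, LinearMap.id_comp]
  have : map (map LinearMap.id (convR LinearMap.id β) ∘ₗ comul) S =
      map (map LinearMap.id (convR LinearMap.id β)) S ∘ₗ
        LinearMap.rTensor C (comul (R := k) (A := C)) := by
    rw [LinearMap.rTensor, ← map_comp, LinearMap.comp_id]
  rw [this, LinearMap.comp_assoc, ← coassoc_symm]
  simp only [← LinearMap.comp_assoc]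
  congr 1
  refine TensorProduct.ext' fun a b => ?_
  simp only [LinearMap.comp_apply, map_tmul, LinearMap.lTensor_tmul, LinearEquiv.coe_coe]
  induction (comul b : C ⊗[k] C) with
  | zero => simp
  | add x y hx hy => simp only [map_add, tmul_add, hx, hy]
  | tmul x y => simp

/-- As a map out of the co-opposite coalgebra, the `β`-contraction is also left colinear along its
second tensor factor, because the antipode reverses the comultiplication. -/
lemma lCompat_betaContr_cop {S : A →ₗ[k] A} (hS : IsAntiCoalgHom S) (β : A →ₗ[k] k) :
    LCompat (betaContr S β ∘ₗ (cop k A).symm.toLinearMap) (sndC k A A)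
      (S ∘ₗ (cop k A).symm.toLinearMap) := by
  have key : map (sndC k A A) LinearMap.id ∘ₗ comul ∘ₗ betaContr S β =
      map S (betaContr S β) ∘ₗ (TensorProduct.comm k A A).toLinearMap ∘ₗ comul := by
    rw [← LinearMap.comp_assoc, map_sndC_id_comp_comul, betaContr, LinearMap.comp_assoc,
      ← LinearMap.comp_assoc comul, ← map_comp, hS.comul_comp, LinearMap.id_comp]
    have h1 : map (convR LinearMap.id β)
        (map S S ∘ₗ (TensorProduct.comm k A A).toLinearMap ∘ₗ comul) =
        map (convR LinearMap.id β) (map S S ∘ₗ (TensorProduct.comm k A A).toLinearMap) ∘ₗ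
         LinearMap.lTensor A (comul (R := k) (A := A)) := by
      rw [LinearMap.lTensor, ← map_comp, LinearMap.comp_id, LinearMap.comp_assoc]
    rw [h1, LinearMap.comp_assoc, ← coassoc]
    simp only [← LinearMap.comp_assoc]
    congr 1
    refine TensorProduct.ext' fun a b => ?_
    simp only [LinearMap.comp_apply, map_tmul, LinearMap.rTensor_tmul, LinearEquiv.coe_coe,
      comm_tmul]
    induction (comul a : A ⊗[k] A) with
    | zero => simp
    | add x y hx hy => simp only [map_add, add_tmul, tmul_add, hx, hy]
    | tmul x y => simp
  have h2 : (TensorProduct.comm k A A).toLinearMap ∘ₗ comul ∘ₗ (cop k A).symm.toLinearMap =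
      map (cop k A).symm.toLinearMap (cop k A).symm.toLinearMap ∘ₗ comul := by
    rw [isAntiCoalgHom_cop_symm.comul_comp]
    simp only [← LinearMap.comp_assoc]
    congr 1
    ext; simp
  have h3 := congr($key ∘ₗ (cop k A).symm.toLinearMap)
  simp only [LinearMap.comp_assoc] at h3
  rw [LCompat, h3, h2, ← LinearMap.comp_assoc, ← map_comp]

/-- If `∑ S(a₁) α(a₂) a₃ = α(a) e`, then multiplication collapses the `α`-contraction to `e`, on
the left of a convolution product. -/
lemma lCompat_alphaContr {S : A →ₗ[k] A} (hS : IsAntiCoalgHom S) (α : A →ₗ[k] k)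
    (m : A ⊗[k] A →ₗ[k] A) (e : A)
    (h : ∀ a, m (map S (convL α LinearMap.id) (comul a)) = α a • e) :
    LCompat (alphaContr S α) m (LinearMap.toSpanSingleton k A e ∘ₗ counit) := by
  -- The coproduct of `S(a₁) ⊗ α(a₂) a₃` is `S(a₂) ⊗ α(a₃) a₄` in its first, and `S(a₁) ⊗ a₅` in
  -- its second tensor factor, so the hypothesis applies to consecutive coproduct indices.
  let G : A ⊗[k] (A ⊗[k] A) →ₗ[k] A ⊗[k] (A ⊗[k] A) :=
    (TensorProduct.leftComm k A A A).toLinearMap ∘ₗ map S LinearMap.id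
  have h1 : map m LinearMap.id ∘ₗ comul ∘ₗ alphaContr S α =
      G ∘ₗ map LinearMap.id (map (m ∘ₗ map S (convL α LinearMap.id)) LinearMap.id) ∘ₗ
        map LinearMap.id (map comul LinearMap.id) ∘ₗ map LinearMap.id comul ∘ₗ comul := by
    rw [alphaContr, comul_tensor]
    have e1 : (map comul comul ∘ₗ map S (convL α LinearMap.id)) ∘ₗ (comul : A →ₗ[k] A ⊗[k] A) =
        map (map S S ∘ₗ (TensorProduct.comm k A A).toLinearMap)
          (map (convL α LinearMap.id) LinearMap.id) ∘ₗ map comul comul ∘ₗ comul := by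
      rw [← map_comp, comul_comp_convL, hS.comul_comp, ← LinearMap.comp_assoc comul,
        ← LinearMap.comp_assoc, ← map_comp]
    rw [LinearMap.comp_assoc, ← LinearMap.comp_assoc comul, e1, map_comul_comul_comp_comul]
    simp only [← LinearMap.comp_assoc]
    congr 3
    refine TensorProduct.ext' fun a x => ?_
    induction x with
    | zero => simp
    | add x y hx hy => simp only [tmul_add, map_add, hx, hy]
    | tmul x d =>
      induction x with
      | zero => simp
      | add x y hx hy => simp only [add_tmul, tmul_add, map_add, hx, hy]
      | tmul b c => simp [G]
  have h2 : (m ∘ₗ map S (convL α LinearMap.id)) ∘ₗ (comul : A →ₗ[k] A ⊗[k] A) =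
      LinearMap.toSpanSingleton k A e ∘ₗ α := by
    ext a; simp [h]
  rw [LCompat, h1]
  have h3 : map LinearMap.id (map (m ∘ₗ map S (convL α LinearMap.id)) LinearMap.id) ∘ₗ
        map LinearMap.id (map comul LinearMap.id) ∘ₗ map LinearMap.id comul =
      (map (LinearMap.id : A →ₗ[k] A) (map (LinearMap.toSpanSingleton k A e ∘ₗ α) LinearMap.id ∘ₗ
        (comul : A →ₗ[k] A ⊗[k] A))) := by
    simp only [← map_comp, ← LinearMap.comp_assoc, h2, LinearMap.id_comp]
  have h4 : map (LinearMap.toSpanSingleton k A e ∘ₗ counit) (alphaContr S α) ∘ₗ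
      (comul : A →ₗ[k] A ⊗[k] A) = TensorProduct.mk k A (A ⊗[k] A) e ∘ₗ alphaContr S α := by
    ext a
    conv_rhs => rw [← counit_smul_comul_left (k := k) a]
    simp only [LinearMap.comp_apply]
    induction (comul a : A ⊗[k] A) with
    | zero => simp
    | add x y hx hy => simp only [map_add, hx, hy]
    | tmul x y => simp [smul_tmul]
  have h5 : G ∘ₗ map LinearMap.id (map (LinearMap.toSpanSingleton k A e ∘ₗ α) LinearMap.id ∘ₗ
      (comul : A →ₗ[k] A ⊗[k] A)) =
      TensorProduct.mk k A (A ⊗[k] A) e ∘ₗ map S (convL α LinearMap.id) := by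
    refine TensorProduct.ext' fun a b => ?_
    simp only [convL, LinearMap.comp_apply, map_tmul]
    induction (comul b : A ⊗[k] A) with
    | zero => simp
    | add x y hx hy => simp only [map_add, tmul_add, hx, hy]
    | tmul x y => simp [G, smul_tmul]
  have h6 := congr((G ∘ₗ $h3) ∘ₗ (comul : A →ₗ[k] A ⊗[k] A))
  have h7 := congr($h5 ∘ₗ (comul : A →ₗ[k] A ⊗[k] A))
  rw [h4, alphaContr]
  simp only [LinearMap.comp_assoc] at h6 h7 ⊢
  exact h6.trans h7

/-- If `∑ c₁ β(c₂) S(c₃) = β(c) e`, then multiplication collapses the `β`-contraction to `e`, on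
the right of a convolution product. -/
lemma rCompat_betaContr {S : C →ₗ[k] A} (hS : IsAntiCoalgHom S) (β : C →ₗ[k] k)
    (m : C ⊗[k] A →ₗ[k] A) (e : A)
    (h : ∀ a, m (map (convR LinearMap.id β) S (comul a)) = β a • e) :
    RCompat (betaContr S β) m (LinearMap.toSpanSingleton k A e ∘ₗ counit) := by
  let G : C ⊗[k] (A ⊗[k] C) →ₗ[k] (C ⊗[k] A) ⊗[k] A :=
    (TensorProduct.assoc k C A A).symm.toLinearMap ∘ₗ
      map LinearMap.id (TensorProduct.comm k A A).toLinearMap ∘ₗ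
        map LinearMap.id (map LinearMap.id S)
  have h1 : map LinearMap.id m ∘ₗ comul ∘ₗ betaContr S β =
      G ∘ₗ map LinearMap.id (map (m ∘ₗ map (convR LinearMap.id β) S) LinearMap.id) ∘ₗ
        map LinearMap.id (map comul LinearMap.id) ∘ₗ map LinearMap.id comul ∘ₗ comul := by
    rw [betaContr, comul_tensor]
    have e1 : (map comul comul ∘ₗ map (convR LinearMap.id β) S) ∘ₗ (comul : C →ₗ[k] C ⊗[k] C) =
        map (map LinearMap.id (convR LinearMap.id β))
          (map S S ∘ₗ (TensorProduct.comm k C C).toLinearMap) ∘ₗ map comul comul ∘ₗ comul := by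
      rw [← map_comp, comul_comp_convR, hS.comul_comp, ← LinearMap.comp_assoc comul,
        ← LinearMap.comp_assoc, ← map_comp]
    rw [LinearMap.comp_assoc, ← LinearMap.comp_assoc comul, e1, map_comul_comul_comp_comul]
    simp only [← LinearMap.comp_assoc]
    congr 3
    refine TensorProduct.ext' fun a x => ?_
    induction x with
    | zero => simp
    | add x y hx hy => simp only [tmul_add, map_add, hx, hy]
    | tmul x d =>
      induction x with
      | zero => simp
      | add x y hx hy => simp only [add_tmul, tmul_add, map_add, hx, hy]
      | tmul b c => simp [G]
  have h2 : (m ∘ₗ map (convR LinearMap.id β) S) ∘ₗ (comul : C →ₗ[k] C ⊗[k] C) =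
      LinearMap.toSpanSingleton k A e ∘ₗ β := by
    ext a; simp [h]
  rw [RCompat, h1]
  have h3 : map LinearMap.id (map (m ∘ₗ map (convR LinearMap.id β) S) LinearMap.id) ∘ₗ
        map LinearMap.id (map comul LinearMap.id) ∘ₗ map LinearMap.id comul =
      (map (LinearMap.id : C →ₗ[k] C) (map (LinearMap.toSpanSingleton k A e ∘ₗ β) LinearMap.id) ∘ₗ
        LinearMap.lTensor C (comul : C →ₗ[k] C ⊗[k] C)) := by
    simp only [LinearMap.lTensor, ← map_comp, ← LinearMap.comp_assoc, h2, LinearMap.id_comp]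
  have h4 : map (betaContr S β) (LinearMap.toSpanSingleton k A e ∘ₗ counit) ∘ₗ
      (comul : C →ₗ[k] C ⊗[k] C) = (TensorProduct.mk k (C ⊗[k] A) A).flip e ∘ₗ betaContr S β := by
    ext a
    conv_rhs => rw [← counit_smul_comul_right (k := k) a]
    simp only [LinearMap.comp_apply]
    induction (comul a : C ⊗[k] C) with
    | zero => simp
    | add x y hx hy => simp only [map_add, hx, hy]
    | tmul x y => simp
  have h5 : G ∘ₗ map LinearMap.id (map (LinearMap.toSpanSingleton k A e ∘ₗ β) LinearMap.id) ∘ₗ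
      (TensorProduct.assoc k C C C).toLinearMap ∘ₗ LinearMap.rTensor C comul =
      (TensorProduct.mk k (C ⊗[k] A) A).flip e ∘ₗ map (convR LinearMap.id β) S := by
    refine TensorProduct.ext' fun a b => ?_
    simp only [convR, LinearMap.comp_apply, map_tmul, LinearMap.rTensor_tmul]
    induction (comul a : C ⊗[k] C) with
    | zero => simp
    | add x y hx hy => simp only [map_add, add_tmul, hx, hy]
    | tmul x y => simp [G, smul_tmul']
  have h6 := congr((G ∘ₗ $h3) ∘ₗ (comul : C →ₗ[k] C ⊗[k] C))
  have h7 := congr($h5 ∘ₗ (comul : C →ₗ[k] C ⊗[k] C))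
  rw [h4, betaContr]
  simp only [LinearMap.comp_assoc] at h6 h7 ⊢
  rw [coassoc] at h7
  exact h6.trans h7

end Contractions

/-! ### Slices of functionals on a tensor product -/

section Slices

variable {k : Type u} [Field k]
variable {C D : Type*} {A : Type v}
  [AddCommGroup C] [Module k C] [Coalgebra k C]
  [AddCommGroup D] [Module k D] [Coalgebra k D]
  [AddCommGroup A] [Module k A] [Coalgebra k A]

lemma map_id_fstC_comp_comul : map LinearMap.id (fstC k C D) ∘ₗ comul =
    (TensorProduct.rightComm k C C D).toLinearMap ∘ₗ map comul LinearMap.id := by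
  refine TensorProduct.ext' fun c d => ?_
  conv_rhs => rw [← counit_smul_comul_right (k := k) d]
  simp only [LinearMap.comp_apply, comul_tmul, LinearEquiv.coe_coe, map_tmul, LinearMap.id_apply]
  induction (comul c : C ⊗[k] C) with
  | zero => simp
  | add x y hx hy => simp only [map_add, add_tmul, hx, hy]
  | tmul x y =>
    induction (comul d : D ⊗[k] D) with
    | zero => simp
    | add x y hx hy => simp only [map_add, tmul_add, hx, hy]
    | tmul x y => simp

lemma rCompat_mk (c : C) : RCompat (TensorProduct.mk k C D c) (sndC k C D) LinearMap.id := by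
  rw [RCompat, ← LinearMap.comp_assoc, map_id_sndC_comp_comul]
  ext d
  simp only [LinearMap.comp_apply, mk_apply, map_tmul, LinearEquiv.coe_coe]
  induction (comul d : D ⊗[k] D) with
  | zero => simp
  | add x y hx hy => simp only [map_add, tmul_add, hx, hy]
  | tmul x y => simp

lemma lCompat_mk_flip (d : D) :
    LCompat ((TensorProduct.mk k C D).flip d) (fstC k C D) LinearMap.id := by
  rw [LCompat, ← LinearMap.comp_assoc, map_fstC_id_comp_comul]
  ext c
  simp only [LinearMap.comp_apply, mk_apply, LinearMap.flip_apply, map_tmul, LinearEquiv.coe_coe]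
  induction (comul c : C ⊗[k] C) with
  | zero => simp
  | add x y hx hy => simp only [map_add, add_tmul, hx, hy]
  | tmul x y => simp

lemma rCompat_mk_flip (d : D) :
    RCompat ((TensorProduct.mk k C D).flip d) (fstC k C D) LinearMap.id := by
  rw [RCompat, ← LinearMap.comp_assoc, map_id_fstC_comp_comul]
  ext c
  simp only [LinearMap.comp_apply, mk_apply, LinearMap.flip_apply, map_tmul, LinearEquiv.coe_coe]
  induction (comul c : C ⊗[k] C) with
  | zero => simp
  | add x y hx hy => simp only [map_add, add_tmul, hx, hy]
  | tmul x y => simp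

lemma pull_id (X : WithConv (C →ₗ[k] k)) : pull LinearMap.id X = X := rfl

/-- Tensoring on the right with a grouplike element. -/
lemma isCoalgHom_mk_flip {g : D} (hg : comul (R := k) g = g ⊗ₜ g)
    (hg' : counit (R := k) g = 1) : IsCoalgHom ((TensorProduct.mk k C D).flip g) where
  counit_comp := by ext c; simp [hg']
  comul_comp := by
    ext c
    simp only [LinearMap.comp_apply, mk_apply, LinearMap.flip_apply, comul_tmul, hg]
    induction (comul c : C ⊗[k] C) with
    | zero => simp
    | add x y hx hy => simp only [map_add, add_tmul, hx, hy]
    | tmul x y => simp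

lemma pull_fstC_mul_pull_sndC_apply (X : WithConv (C →ₗ[k] k)) (Y : WithConv (D →ₗ[k] k))
    (c : C) (d : D) : (pull (fstC k C D) X * pull (sndC k C D) Y) (c ⊗ₜ d) = X c * Y d := by
  have h := (rCompat_mk c).pull_mul (pull (fstC k C D) X) Y
  have h1 : pull (TensorProduct.mk k C D c) (pull (fstC k C D) X) = X c • 1 := by
    ext d; simp [mul_comm]
  rw [h1, pull_id, smul_mul_assoc, one_mul] at h
  exact congr($h d)

lemma pull_sndC_mul (X : WithConv (A →ₗ[k] k)) (Y : WithConv (C ⊗[k] A →ₗ[k] k)) :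
    pull (sndC k C A) X * Y = pull (map LinearMap.id (convL X.ofConv LinearMap.id)) Y := by
  have h := congr(LinearMap.mul' k k ∘ₗ map X.ofConv Y.ofConv ∘ₗ
    $(map_sndC_id_comp_comul (k := k) (C := C) (D := A)))
  refine WithConv.ext (LinearMap.ext fun x => ?_)
  refine Eq.trans (b := (LinearMap.mul' k k ∘ₗ map X.ofConv Y.ofConv ∘ₗ
    map (sndC k C A) LinearMap.id ∘ₗ comul) x) ?_ ?_
  · rw [convMul_eq, pull]
    simp only [← LinearMap.comp_assoc]
    rw [LinearMap.comp_assoc _ (map X.ofConv Y.ofConv), ← map_comp]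
    rfl
  · rw [h]
    induction x with
    | zero => simp only [map_zero]
    | add x y hx hy => rw [map_add, hx, hy, map_add]
    | tmul c a =>
      refine Eq.trans ?_ (pull_apply _ _ _).symm
      simp only [convL, LinearMap.comp_apply, map_tmul]
      induction (comul a : A ⊗[k] A) with
      | zero => simp
      | add x y hx hy => simp only [map_add, tmul_add, hx, hy]
      | tmul x y => simp

lemma lCompat_mk (c : C) : LCompat (TensorProduct.mk k C D c) (sndC k C D) LinearMap.id := by
  rw [LCompat, ← LinearMap.comp_assoc, map_sndC_id_comp_comul]
  ext d
  simp only [LinearMap.comp_apply, mk_apply, map_tmul, LinearEquiv.coe_coe]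
  induction (comul d : D ⊗[k] D) with
  | zero => simp
  | add x y hx hy => simp only [map_add, tmul_add, hx, hy]
  | tmul x y => simp

lemma pull_fstC_mul_apply (X : WithConv (A →ₗ[k] k)) (Y : WithConv (A ⊗[k] D →ₗ[k] k))
    (a : A) (d : D) :
    (pull (fstC k A D) X * Y) (a ⊗ₜ d) = Y (convL X.ofConv LinearMap.id a ⊗ₜ d) := by
  have h := (lCompat_mk_flip (C := A) d).pull_mul X Y
  refine congr($h a).trans ?_
  rw [LinearMap.convMul_apply]
  simp only [convL, LinearMap.comp_apply]
  induction (comul a : A ⊗[k] A) with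
  | zero => simp
  | add x y hx hy => simp only [map_add, add_tmul, hx, hy]
  | tmul x y => simp [pull, ← smul_tmul']

lemma mul_pull_sndC_apply (X : WithConv (C ⊗[k] D →ₗ[k] k)) (Y : WithConv (D →ₗ[k] k))
    (c : C) (d : D) :
    (X * pull (sndC k C D) Y) (c ⊗ₜ d) = (pull (TensorProduct.mk k C D c) X * Y) d :=
  congr($((rCompat_mk (D := D) c).pull_mul X Y) d)

/-- Tensoring on the left with a grouplike element. -/
lemma isCoalgHom_mk {g : D} (hg : comul (R := k) g = g ⊗ₜ g)
    (hg' : counit (R := k) g = 1) : IsCoalgHom (TensorProduct.mk k D C g) where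
  counit_comp := by ext c; simp [hg']
  comul_comp := by
    ext c
    simp only [LinearMap.comp_apply, mk_apply, comul_tmul, hg]
    induction (comul c : C ⊗[k] C) with
    | zero => simp
    | add x y hx hy => simp only [map_add, tmul_add, hx, hy]
    | tmul x y => simp

lemma sndC_comp_assoc : sndC k A (A ⊗[k] D) ∘ₗ (TensorProduct.assoc k A A D).toLinearMap =
    map (sndC k A A) LinearMap.id := by
  ext; simp [smul_tmul']

lemma fstC_comp_assoc : fstC k A (A ⊗[k] D) ∘ₗ (TensorProduct.assoc k A A D).toLinearMap =
    fstC k A D ∘ₗ map (fstC k A A) LinearMap.id := by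
  ext; simp [mul_smul]

/-- A left colinear map `κ` commutes with the comultiplication of the first tensor factor. -/
lemma map_id_comp_assoc_comul {P : Type*} [AddCommGroup P] [Module k P] [Coalgebra k P]
    {κ : A ⊗[k] D →ₗ[k] A ⊗[k] P} (hκ : LCompat κ (fstC k A P) (fstC k A D)) :
    (TensorProduct.assoc k A A P).toLinearMap ∘ₗ map comul LinearMap.id ∘ₗ κ =
      map LinearMap.id κ ∘ₗ (TensorProduct.assoc k A A D).toLinearMap ∘ₗ
        map comul LinearMap.id := by
  rw [LCompat, ← LinearMap.comp_assoc, map_fstC_id_comp_comul, LinearMap.comp_assoc] at hκ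
  rw [hκ, ← map_fstC_id_comp_comul, ← LinearMap.comp_assoc, ← map_comp, LinearMap.id_comp,
    LinearMap.comp_id]

end Slices

section
variable {k : Type u} [Field k] {A : Type v} [AddCommGroup A] [Module k A] [Coalgebra k A]

lemma comp_convR_of_isCoalgHom {C : Type v} [AddCommGroup C] [Module k C] [Coalgebra k C]
    {σ : C →ₗ[k] A} (hσ : IsCoalgHom σ) (β : A →ₗ[k] k) :
    σ ∘ₗ convR LinearMap.id (β ∘ₗ σ) = convR LinearMap.id β ∘ₗ σ := by
  have h := congr((TensorProduct.rid k A).toLinearMap ∘ₗ map LinearMap.id β ∘ₗ $hσ.comul_comp)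
  rw [convR, convR, LinearMap.comp_assoc, LinearMap.comp_assoc, h]
  simp only [← LinearMap.comp_assoc]
  congr 1
  ext; simp

lemma map_comp_comul_of_isCoalgHom {C : Type*} [AddCommGroup C] [Module k C] [Coalgebra k C]
    {M N : Type*} [AddCommGroup M] [Module k M] [AddCommGroup N] [Module k N]
    {σ : C →ₗ[k] A} (hσ : IsCoalgHom σ) (f : A →ₗ[k] M) (g : A →ₗ[k] N) :
    map (f ∘ₗ σ) (g ∘ₗ σ) ∘ₗ comul = map f g ∘ₗ comul ∘ₗ σ := by
  rw [hσ.comul_comp, map_comp, LinearMap.comp_assoc]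

/-- If `∑ h(x₁) q(x₂, a) = ∑ q(x, a₁) h(a₂)` for all `h`, then on `A^cop ⊗ A` the product `q * X`
takes at `n ⊗ a` the value `∑ X(n₁, n₂) q(n₃, a)`. -/
lemma balanced_mul_apply {q : WithConv (A ⊗[k] A →ₗ[k] k)}
    (hq : ∀ h, pull (fstC k A A) h * q = q * pull (sndC k A A) h)
    (X : WithConv (Cop A ⊗[k] A →ₗ[k] k)) (n a : A) :
    (pull (map (cop k A).symm.toLinearMap LinearMap.id) q * X) (cop k A n ⊗ₜ a) =
      (pull (map (cop k A).toLinearMap LinearMap.id ∘ₗ comul) X *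
        pull ((TensorProduct.mk k A A).flip a) q) n := by
  obtain ⟨ι, s, u, w, hn⟩ : ∃ (ι : Type v) (s : Finset ι) (u w : ι → A),
      comul (R := k) n = ∑ i ∈ s, u i ⊗ₜ w i :=
    ⟨_, _, _, _, (ℛ k n).eq.symm⟩
  have h1 : (pull (map (cop k A).symm.toLinearMap LinearMap.id) q * X) (cop k A n ⊗ₜ a) =
      ∑ i ∈ s, (q * pull (sndC k A A) (pull (TensorProduct.mk k (Cop A) A (cop k A (u i))) X))
        (w i ⊗ₜ a) := by
    have h2 : ∀ i, (q * pull (sndC k A A) (pull (TensorProduct.mk k (Cop A) A (cop k A (u i))) X))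
        (w i ⊗ₜ a) = (pull (TensorProduct.mk k A A (w i)) q *
          pull (TensorProduct.mk k (Cop A) A (cop k A (u i))) X) a := fun i => by
      rw [← pull_id (pull (TensorProduct.mk k (Cop A) A (cop k A (u i))) X),
        ← (rCompat_mk (w i)).pull_mul]
      rfl
    simp only [h2, LinearMap.convMul_apply, comul_tmul, comul_cop, hn]
    induction (comul a : A ⊗[k] A) with
    | zero => simp
    | add x y hx hy => simp only [map_add, tmul_add, hx, hy, Finset.sum_add_distrib]
    | tmul x y => simp [sum_tmul, pull]
  have h3 : ∀ i, (q * pull (sndC k A A)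
      (pull (TensorProduct.mk k (Cop A) A (cop k A (u i))) X)) (w i ⊗ₜ a) =
      (pull (TensorProduct.mk k (Cop A) A (cop k A (u i)) ) X *
        pull ((TensorProduct.mk k A A).flip a) q) (w i) := fun i => by
    rw [← hq, ← pull_id (pull (TensorProduct.mk k (Cop A) A (cop k A (u i))) X),
      ← (lCompat_mk_flip a).pull_mul]
    rfl
  simp only [h1, h3]
  -- Both steps replace a product by a sum over `Δ(n)`; coassociativity recombines them.
  have h4 : ∑ i ∈ s, (pull (TensorProduct.mk k (Cop A) A (cop k A (u i)) ) X *
        pull ((TensorProduct.mk k A A).flip a) q) (w i) =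
      (LinearMap.mul' k k ∘ₗ map (X.ofConv ∘ₗ map (cop k A).toLinearMap LinearMap.id)
        (pull ((TensorProduct.mk k A A).flip a) q).ofConv)
        ((TensorProduct.assoc k A A A).symm (LinearMap.lTensor A comul (comul n))) := by
    simp only [hn, map_sum, LinearMap.lTensor_tmul]
    refine Finset.sum_congr rfl fun i _ => ?_
    rw [LinearMap.convMul_apply]
    induction (comul (w i) : A ⊗[k] A) with
    | zero => simp
    | add x y hx hy => simp only [map_add, tmul_add, hx, hy]
    | tmul x y => simp [pull]
  rw [h4, coassoc_symm_apply, LinearMap.convMul_apply]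
  induction (comul n : A ⊗[k] A) with
  | zero => simp
  | add x y hx hy => simp only [map_add, hx, hy]
  | tmul x y => simp [pull]

end

section Slices
variable {k : Type u} [Field k]
variable {C M : Type v}
  [AddCommGroup C] [Module k C] [Coalgebra k C] [AddCommGroup M] [Module k M]

lemma pull_convR (f : C →ₗ[k] M) (X : WithConv (C →ₗ[k] k)) (h : M →ₗ[k] k) :
    toConv (h ∘ₗ f) * X = toConv (h ∘ₗ convR f X.ofConv) := by
  refine WithConv.ext ?_
  rw [convMul_eq, convR]
  simp only [← LinearMap.comp_assoc]
  congr 1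
  ext x y; simp [mul_comm]

lemma pull_convL (f : C →ₗ[k] M) (X : WithConv (C →ₗ[k] k)) (h : M →ₗ[k] k) :
    X * toConv (h ∘ₗ f) = toConv (h ∘ₗ convL X.ofConv f) := by
  refine WithConv.ext ?_
  rw [convMul_eq, convL]
  simp only [← LinearMap.comp_assoc]
  congr 1
  ext x y; simp

end Slices

section Slices
variable {k : Type u} [Field k] {A Q : Type v}
  [AddCommGroup A] [Module k A] [Coalgebra k A] [AddCommGroup Q] [Module k Q] [Coalgebra k Q]

/-- The product of the form `X(x, g(w))` with `Y(x, w)` has the shape `∑ X(x₁, M(x₂, w))`, for the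
linear map `M(x, w) = ∑ g(w₁) Y(x, w₂)`. -/
lemma pull_map_id_mul (X : WithConv (A ⊗[k] A →ₗ[k] k)) (g : Q →ₗ[k] A)
    (Y : WithConv (A ⊗[k] Q →ₗ[k] k)) :
    pull (map LinearMap.id g) X * Y = pull (map LinearMap.id (convR (g ∘ₗ sndC k A Q) Y.ofConv) ∘ₗ
      (TensorProduct.assoc k A A Q).toLinearMap ∘ₗ map comul LinearMap.id) X := by
  have h1 (y : A) (w : Q) : convR (g ∘ₗ sndC k A Q) Y.ofConv (y ⊗ₜ w) =
      TensorProduct.rid k A (map g (Y.ofConv ∘ₗ TensorProduct.mk k A Q y) (comul w)) := by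
    have h := congr(map g Y.ofConv ($(lCompat_mk (k := k) (D := Q) y) w))
    simp only [LinearMap.comp_apply] at h
    rw [← LinearMap.comp_apply (map g _), ← map_comp, ← LinearMap.comp_apply (map g _),
      ← map_comp] at h
    exact congr(TensorProduct.rid k A $h)
  refine WithConv.ext (TensorProduct.ext' fun a w => ?_)
  rw [LinearMap.convMul_apply, comul_tmul]
  refine Eq.trans ?_ (pull_apply _ _ _).symm
  simp only [LinearMap.comp_apply, map_tmul, LinearMap.id_apply]
  induction (comul a : A ⊗[k] A) with
  | zero => simp
  | add x y hx hy => simp only [map_add, add_tmul, hx, hy]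
  | tmul x y =>
    simp only [LinearEquiv.coe_coe, assoc_tmul, map_tmul, h1, LinearMap.id_apply]
    induction (comul w : Q ⊗[k] Q) with
    | zero => simp
    | add x y hx hy => simp only [map_add, tmul_add, hx, hy]
    | tmul z w => simp [pull, mul_comm]

end Slices

/-! ### The data needed to transport integrals -/

/-- The part of a dual quasi-Hopf algebra structure that is used to pass from a nonzero left
integral to a nonzero right integral. The cocycle identity and the inverse of the reassociator are
left out, which makes it easy to form the opposite-co-opposite structure. -/
structure Core (k : Type u) (A : Type v) [Field k] [AddCommGroup A] [Module k A]
    [Coalgebra k A] where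
  mul : A ⊗[k] A →ₗ[k] A
  isCoalgHom_mul : IsCoalgHom mul
  one : A
  comul_one : comul (R := k) one = one ⊗ₜ one
  counit_one : counit (R := k) one = 1
  one_mul : ∀ a : A, mul (one ⊗ₜ a) = a
  mul_one : ∀ a : A, mul (a ⊗ₜ one) = a
  φ : WithConv (A ⊗[k] (A ⊗[k] A) →ₗ[k] k)
  quasi_assoc : ∀ h : WithConv (A →ₗ[k] k),
    pull (mulRight mul) h * φ = φ * pull (mulLeft mul) h
  φ_one : ∀ a b : A, φ (a ⊗ₜ (one ⊗ₜ b)) = counit (R := k) a * counit (R := k) b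
  S : A →ₗ[k] A
  isAntiCoalgHom_S : IsAntiCoalgHom S
  α : A →ₗ[k] k
  β : A →ₗ[k] k
  antipode_alpha : ∀ a : A, mul (map S (convL α LinearMap.id) (comul a)) = α a • one
  beta_antipode : ∀ a : A, mul (map (convR LinearMap.id β) S (comul a)) = β a • one
  zigzag : φ.ofConv ∘ₗ map (convR LinearMap.id β)
    (map S (convL α LinearMap.id) ∘ₗ comul) ∘ₗ comul = counit

section Integrals
variable {k : Type u} [Field k] {A : Type v} [AddCommGroup A] [Module k A] [Coalgebra k A]

/-- `T` is a left integral, with `e` in the role of the unit element. -/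
def IsLeftInt (e : A) (T : WithConv (A →ₗ[k] k)) : Prop :=
  ∀ h : WithConv (A →ₗ[k] k), h * T = h e • T

/-- `T` is a right integral, with `e` in the role of the unit element. -/
def IsRightInt (e : A) (T : WithConv (A →ₗ[k] k)) : Prop :=
  ∀ h : WithConv (A →ₗ[k] k), T * h = h e • T

end Integrals

namespace Core

variable {k : Type u} {A : Type v} [Field k] [AddCommGroup A] [Module k A] [Coalgebra k A]
variable (K : Core k A)

/-- `a ↦ ε(a) 1` -/
def eta {C : Type*} [AddCommGroup C] [Module k C] [Coalgebra k C] : C →ₗ[k] A :=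
  LinearMap.toSpanSingleton k A K.one ∘ₗ counit

lemma counit_mul (x y : A) :
    counit (R := k) (K.mul (x ⊗ₜ y)) = counit (R := k) x * counit (R := k) y := by
  have := congr($(K.isCoalgHom_mul.counit_comp) (x ⊗ₜ y))
  simpa [mul_comm] using this

lemma mul_comp_map_id_eta : K.mul ∘ₗ map LinearMap.id K.eta = fstC k A A := by
  ext x y; simp [eta, K.mul_one]

lemma mul_comp_map_eta_id {C : Type*} [AddCommGroup C] [Module k C] [Coalgebra k C] :
    K.mul ∘ₗ map K.eta LinearMap.id = sndC k C A := by
  refine TensorProduct.ext' fun c a => ?_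
  simp [eta, K.one_mul, smul_tmul]

lemma lCompat_alpha : LCompat (alphaContr K.S K.α) K.mul K.eta :=
  lCompat_alphaContr K.isAntiCoalgHom_S _ _ _ K.antipode_alpha

section
variable (D : Type*) [AddCommGroup D] [Module k D] [Coalgebra k D]

/-- `x ⊗ y ⊗ d ↦ x y ⊗ d` -/
def mulFst : A ⊗[k] (A ⊗[k] D) →ₗ[k] A ⊗[k] D :=
  map K.mul LinearMap.id ∘ₗ (TensorProduct.assoc k A A D).symm.toLinearMap

@[simp] lemma mulFst_tmul (x y : A) (d : D) :
    K.mulFst D (x ⊗ₜ (y ⊗ₜ d)) = K.mul (x ⊗ₜ y) ⊗ₜ d := by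
  simp [mulFst]

lemma isCoalgHom_mulFst : IsCoalgHom (K.mulFst D) :=
  (K.isCoalgHom_mul.map IsCoalgHom.id).comp isCoalgHom_assoc_symm

lemma mulFst_comp_assoc : K.mulFst D ∘ₗ (TensorProduct.assoc k A A D).toLinearMap =
    map K.mul LinearMap.id := by
  rw [mulFst, LinearMap.comp_assoc]
  simp

end

lemma alpha_one_ne_zero : K.α K.one ≠ 0 ∧ K.β K.one ≠ 0 := by
  have h := congr($(K.zigzag) K.one)
  simp only [LinearMap.comp_apply, K.comul_one, map_tmul, convR, convL, K.counit_one] at h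
  constructor <;> rintro h' <;> simp [h'] at h

lemma S_one : K.S K.one = K.one := by
  have h := K.beta_antipode K.one
  simp only [K.comul_one, map_tmul, convR, LinearMap.comp_apply] at h
  simpa [← smul_tmul', K.one_mul, K.alpha_one_ne_zero.2] using h

section LeftToRight

variable (lam : WithConv (A →ₗ[k] k))

/-- The form `q` on `A ⊗ A` attached to `λ`: the composite of `φ(x, y, z) * λ(x y) ε(z)` with the
`α`-contraction of the last two variables. -/
def twist : WithConv (A ⊗[k] A →ₗ[k] k) :=
  pull (map LinearMap.id (alphaContr K.S K.α))
    (K.φ * pull (K.mulFst A) (pull (fstC k A A) lam))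

variable {lam} (hlam : IsLeftInt K.one lam)
include hlam

/-- `λ(u) h(z) = ∑ h(u₁ z) λ(u₂)`: both sides arise from `h(· z) * λ`. -/
lemma leftInt_mul (h : WithConv (A →ₗ[k] k)) :
    pull (fstC k A A) lam * pull (sndC k A A) h = pull K.mul h * pull (fstC k A A) lam := by
  refine WithConv.ext (TensorProduct.ext' fun u z => ?_)
  refine (pull_fstC_mul_pull_sndC_apply _ _ _ _).trans ?_
  have h1 := (rCompat_mk_flip (C := A) z).pull_mul (pull K.mul h) lam
  rw [pull_id, hlam] at h1
  have h2 := congr($h1 u)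
  refine Eq.trans ?_ h2.symm
  simp [K.one_mul, mul_comm]

lemma twist_balanced (h : WithConv (A →ₗ[k] k)) :
    pull (fstC k A A) h * K.twist lam = K.twist lam * pull (sndC k A A) h := by
  have hL : LCompat (map LinearMap.id (alphaContr K.S K.α)) (mulRight K.mul) (fstC k A A) := by
    have := ((LCompat.of_hom (IsCoalgHom.id (P := A) (k := k)) LinearMap.id).map
      K.lCompat_alpha).postcomp K.mul
    rwa [LinearMap.id_comp, K.mul_comp_map_id_eta] at this
  have hR : RCompat (map LinearMap.id (alphaContr K.S K.α))
      (sndC k A A ∘ₗ K.mulFst A) (sndC k A A) := by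
    have := ((RCompat.of_hom (IsCoalgHom.id (P := A) (k := k)) LinearMap.id).map
      (rCompat_alphaContr K.S K.α)).postcomp (sndC k A A)
    have e : sndC k A A ∘ₗ K.mulFst A = sndC k A A ∘ₗ map LinearMap.id (sndC k A A) := by
      ext x y z; simp [mulFst, K.counit_mul, mul_smul, smul_comm (counit (R := k) x)]
    rw [e]
    rwa [LinearMap.id_comp, map_id, LinearMap.comp_id] at this
  rw [twist, ← hR.pull_mul, mul_assoc, ← pull_pull, ← pull_mul (K.isCoalgHom_mulFst A),
    K.leftInt_mul hlam, pull_mul (K.isCoalgHom_mulFst A), ← mul_assoc]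
  have : pull (K.mulFst A) (pull K.mul h) = pull (mulLeft K.mul) h := rfl
  rw [this, ← K.quasi_assoc, mul_assoc, hL.pull_mul]

omit hlam in
lemma twist_one (n : A) : K.twist lam (n ⊗ₜ K.one) = K.α K.one * lam n := by
  have hj : IsCoalgHom ((TensorProduct.mk k A (A ⊗[k] A)).flip (K.one ⊗ₜ K.one)) :=
    isCoalgHom_mk_flip (by simp [K.comul_one]) (by simp [K.counit_one])
  have h1 := pull_mul hj K.φ (pull (K.mulFst A) (pull (fstC k A A) lam))
  have h2 : pull ((TensorProduct.mk k A (A ⊗[k] A)).flip (K.one ⊗ₜ K.one)) K.φ = 1 := by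
    ext a
    refine (K.φ_one a K.one).trans ?_
    simp [K.counit_one]
  have h3 : pull ((TensorProduct.mk k A (A ⊗[k] A)).flip (K.one ⊗ₜ K.one))
      (pull (K.mulFst A) (pull (fstC k A A) lam)) = lam := by
    ext a
    simp [mulFst, K.counit_one, K.mul_one]
  rw [h2, h3, _root_.one_mul] at h1
  have h4 := congr($h1 n)
  rw [twist, pull_apply, map_tmul, alphaContr]
  simp only [LinearMap.comp_apply, K.comul_one, map_tmul, convL, K.S_one]
  simp only [LinearEquiv.coe_coe, lid_tmul, LinearMap.id_apply, tmul_smul, map_smul, smul_eq_mul]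
  congr 1

end LeftToRight
end Core

/-! ### From left integrals to right integrals -/

namespace Core

variable {k : Type u} {A : Type v} [Field k] [AddCommGroup A] [Module k A] [Coalgebra k A]
variable (K : Core k A)

/-- The antipode, as a coalgebra map `A^cop → A`. -/
def Sc : Cop A →ₗ[k] A := K.S ∘ₗ (cop k A).symm.toLinearMap

lemma isCoalgHom_Sc : IsCoalgHom K.Sc := K.isAntiCoalgHom_S.comp isAntiCoalgHom_cop_symm

section LeftToRight

variable (lam : WithConv (A →ₗ[k] k))

/-- The form `t(n, a) = ∑ q(n, a₁) α(a₂)`, regarded as a form on `A^cop ⊗ A`. -/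
def twistAlpha : WithConv (Cop A ⊗[k] A →ₗ[k] k) :=
  pull (map (cop k A).symm.toLinearMap LinearMap.id) (K.twist lam) *
    pull (sndC k (Cop A) A) (toConv K.α)

/-- `n ⊗ a ↦ n₁ β(S(n₂)) ⊗ S(S(n₃)) ⊗ a`, the coproduct being that of `A^cop`. -/
def copContr : Cop A ⊗[k] A →ₗ[k] Cop A ⊗[k] (A ⊗[k] A) :=
  (TensorProduct.assoc k (Cop A) A A).toLinearMap ∘ₗ
    map (betaContr (K.S ∘ₗ K.Sc) (K.β ∘ₗ K.Sc)) LinearMap.id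

/-- The contraction of `t(n, y a) * φ(S(n), y, a)`; it is a family of right integrals in the
variable `a`. -/
def rightIntFamily : WithConv (Cop A ⊗[k] A →ₗ[k] k) :=
  pull K.copContr (pull (map LinearMap.id K.mul) (K.twistAlpha lam) *
    pull (map K.Sc LinearMap.id) K.φ)
lemma rCompat_copContr : RCompat K.copContr (mulLeft K.mul ∘ₗ map K.Sc LinearMap.id)
    (sndC k (Cop A) A) := by
  have h1 := rCompat_betaContr (K.isAntiCoalgHom_S.comp_hom K.isCoalgHom_Sc) (K.β ∘ₗ K.Sc)
    (K.mul ∘ₗ map K.Sc LinearMap.id) K.one fun n => by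
      have h2 := map_comp_comul_of_isCoalgHom K.isCoalgHom_Sc (convR LinearMap.id K.β) K.S
      rw [← comp_convR_of_isCoalgHom K.isCoalgHom_Sc] at h2
      refine Eq.trans ?_ (K.beta_antipode (K.Sc n))
      have h3 := congr(K.mul ($h2 n))
      refine Eq.trans ?_ h3
      simp only [LinearMap.comp_apply]
      rw [← LinearMap.comp_apply (map _ _), ← map_comp]
      rfl
  have h2 := (h1.map (RCompat.of_hom (IsCoalgHom.id (P := A) (k := k)) LinearMap.id)).postcomp K.mul
  have h3 : K.mul ∘ₗ map (LinearMap.toSpanSingleton k A K.one ∘ₗ counit)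
      (LinearMap.id ∘ₗ LinearMap.id) = sndC k (Cop A) A := K.mul_comp_map_eta_id
  rw [h3] at h2
  refine RCompat.comp_hom ?_ isCoalgHom_assoc
  convert h2 using 1
  ext; rfl

variable {lam} (hlam : IsLeftInt K.one lam)
include hlam

lemma twistAlpha_mul (h : WithConv (A →ₗ[k] k)) :
    K.twistAlpha lam * pull (K.mul ∘ₗ map K.Sc LinearMap.id) h =
      h K.one • K.twistAlpha lam := by
  refine WithConv.ext (TensorProduct.ext' fun c a => ?_)
  obtain ⟨n, rfl⟩ := (cop k A).surjective c
  have h1 := balanced_mul_apply (K.twist_balanced hlam) (pull (sndC k (Cop A) A) (toConv K.α) *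
    pull (K.mul ∘ₗ map K.Sc LinearMap.id) h) n a
  have h2 := balanced_mul_apply (K.twist_balanced hlam) (pull (sndC k (Cop A) A) (toConv K.α)) n a
  have h3 : pull (map (cop k A).toLinearMap LinearMap.id ∘ₗ comul)
      (pull (sndC k (Cop A) A) (toConv K.α) * pull (K.mul ∘ₗ map K.Sc LinearMap.id) h) =
      h K.one • toConv K.α := by
    rw [pull_sndC_mul, pull_pull, pull_pull]
    ext b
    have := congr(h $(K.antipode_alpha b))
    rw [map_smul, smul_eq_mul, mul_comm] at this
    refine Eq.trans ?_ this
    refine congr(h.ofConv (K.mul $(?_)))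
    simp only [LinearMap.comp_apply]
    induction (comul b : A ⊗[k] A) with
    | zero => simp
    | add x y hx hy => simp only [map_add, hx, hy]
    | tmul x y => simp [Sc]
  have h4 : pull (map (cop k A).toLinearMap LinearMap.id ∘ₗ comul)
      (pull (sndC k (Cop A) A) (toConv K.α)) = toConv K.α := by
    ext b
    conv_rhs => rw [← counit_smul_comul_left (k := k) b]
    simp only [pull_apply, LinearMap.comp_apply]
    induction (comul b : A ⊗[k] A) with
    | zero => simp
    | add x y hx hy => simp only [map_add, hx, hy]
    | tmul x y => simp [counit_cop]
  rw [h3, smul_mul_assoc] at h1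
  rw [h4] at h2
  rw [← mul_assoc] at h1
  exact h1.trans congr(h K.one * $h2.symm)

lemma rightIntFamily_mul (h : WithConv (A →ₗ[k] k)) :
    K.rightIntFamily lam * pull (sndC k (Cop A) A) h = h K.one • K.rightIntFamily lam := by
  have hs : IsCoalgHom (map K.Sc (LinearMap.id : A ⊗[k] A →ₗ[k] _)) :=
    K.isCoalgHom_Sc.map IsCoalgHom.id
  have hr : IsCoalgHom (map (LinearMap.id : Cop A →ₗ[k] _) K.mul) :=
    IsCoalgHom.id.map K.isCoalgHom_mul
  rw [rightIntFamily, ← K.rCompat_copContr.pull_mul, ← pull_pull, mul_assoc, ← pull_mul hs,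
    ← K.quasi_assoc, pull_mul hs, ← mul_assoc]
  have : pull (map K.Sc LinearMap.id) (pull (mulRight K.mul) h) =
      pull (map LinearMap.id K.mul) (pull (K.mul ∘ₗ map K.Sc LinearMap.id) h) := by
    rw [pull_pull, pull_pull]
    congr 1
    ext; rfl
  rw [this, ← pull_mul hr, K.twistAlpha_mul hlam, pull_smul, smul_mul_assoc, pull_smul]

lemma isRightInt_rightIntFamily (n : Cop A) :
    IsRightInt K.one (pull (TensorProduct.mk k (Cop A) A n) (K.rightIntFamily lam)) := fun h => by
  rw [← pull_id h, ← (rCompat_mk n).pull_mul, K.rightIntFamily_mul hlam]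
  rfl

omit hlam in
lemma twistAlpha_one (n : A) :
    K.twistAlpha lam (cop k A n ⊗ₜ K.one) = K.α K.one ^ 2 * lam n := by
  have h := pull_mul (isCoalgHom_mk_flip (C := Cop A) K.comul_one K.counit_one)
    (pull (map (cop k A).symm.toLinearMap LinearMap.id) (K.twist lam))
    (pull (sndC k (Cop A) A) (toConv K.α))
  have h1 : pull ((TensorProduct.mk k (Cop A) A).flip K.one)
      (pull (sndC k (Cop A) A) (toConv K.α)) = K.α K.one • 1 := by
    ext x; simp [mul_comm]
  rw [h1, mul_smul_comm, _root_.mul_one] at h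
  refine congr($h (cop k A n)).trans ?_
  have := K.twist_one (lam := lam) n
  rw [sq, mul_assoc, ← this]
  rfl

omit hlam in
/-- Contracting the family further, with `n ↦ ∑ n₁ ⊗ α(S(n₂)) S(n₃)` on `A^cop`, gives back
`t(n, 1)`, which is a nonzero multiple of `λ(n)`. -/
lemma rightIntFamily_ne_zero (h0 : lam ≠ 0) : K.rightIntFamily lam ≠ 0 := by
  intro hT
  apply h0
  let θ : Cop A →ₗ[k] Cop A ⊗[k] A := map LinearMap.id (convL K.α LinearMap.id ∘ₗ K.Sc) ∘ₗ comul
  let μ : Cop A →ₗ[k] Cop A ⊗[k] A := betaContr K.Sc (K.β ∘ₗ K.Sc)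
  -- The two orders of nesting an `α`- and a `β`-contraction agree by coassociativity.
  have hθ : K.copContr ∘ₗ θ = map LinearMap.id (alphaContr K.S K.α) ∘ₗ μ := by
    have e1 : map LinearMap.id (alphaContr K.S K.α) ∘ₗ μ =
        map (convR LinearMap.id (K.β ∘ₗ K.Sc)) (map (K.S ∘ₗ K.Sc) (convL K.α LinearMap.id ∘ₗ K.Sc))
          ∘ₗ LinearMap.lTensor (Cop A) comul ∘ₗ comul := by
      have := map_comp_comul_of_isCoalgHom K.isCoalgHom_Sc K.S (convL K.α LinearMap.id)
      have hμ : μ = map (convR LinearMap.id (K.β ∘ₗ K.Sc)) K.Sc ∘ₗ comul := rfl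
      rw [LinearMap.lTensor, ← LinearMap.comp_assoc, ← map_comp, this, LinearMap.comp_id,
        hμ, ← LinearMap.comp_assoc, ← map_comp, LinearMap.id_comp]
      rfl
    rw [e1, ← coassoc]
    simp only [θ, copContr, ← LinearMap.comp_assoc]
    congr 1
    refine TensorProduct.ext' fun a b => ?_
    simp only [betaContr, LinearMap.comp_apply, map_tmul, LinearMap.rTensor_tmul]
    induction (comul a : Cop A ⊗[k] Cop A) with
    | zero => simp
    | add x y hx hy => simp only [map_add, add_tmul, hx, hy]
    | tmul x y => simp
  have hr : LCompat (map (LinearMap.id : Cop A →ₗ[k] _) (alphaContr K.S K.α))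
      (map LinearMap.id K.mul) (map LinearMap.id K.eta) :=
    (LCompat.of_hom (IsCoalgHom.id (P := Cop A) (k := k)) LinearMap.id).map K.lCompat_alpha
  have h1 : pull θ (K.rightIntFamily lam) = pull ((TensorProduct.mk k (Cop A) A).flip K.one)
      (K.twistAlpha lam) := by
    rw [rightIntFamily, pull_pull, hθ, ← pull_pull, hr.pull_mul]
    have e1 : pull (map LinearMap.id K.eta) (K.twistAlpha lam) =
        pull (fstC k (Cop A) A) (pull ((TensorProduct.mk k (Cop A) A).flip K.one)
          (K.twistAlpha lam)) := by
      rw [pull_pull]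
      congr 1
      refine TensorProduct.ext' fun a b => ?_
      simp [eta]
    have e2 : pull μ (pull (map LinearMap.id (alphaContr K.S K.α))
        (pull (map K.Sc LinearMap.id) K.φ)) = 1 := by
      have e3 : map K.Sc LinearMap.id ∘ₗ map LinearMap.id (alphaContr K.S K.α) ∘ₗ μ =
          map (convR LinearMap.id K.β) (alphaContr K.S K.α) ∘ₗ comul ∘ₗ K.Sc := by
        rw [← map_comp_comul_of_isCoalgHom K.isCoalgHom_Sc,
          ← comp_convR_of_isCoalgHom K.isCoalgHom_Sc]
        simp only [μ, betaContr, ← LinearMap.comp_assoc, ← map_comp, LinearMap.id_comp]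
      rw [pull_pull, pull_pull, e3]
      refine WithConv.ext ?_
      have := congr($(K.zigzag) ∘ₗ K.Sc)
      rw [K.isCoalgHom_Sc.counit_comp] at this
      exact this
    rw [e1, (lCompat_betaContr _ _).pull_mul, e2, _root_.mul_one, pull_id]
  rw [hT, pull_zero] at h1
  refine WithConv.ext (LinearMap.ext fun n => ?_)
  have h2 := congr($h1 (cop k A n))
  have h3 := K.twistAlpha_one (lam := lam) n
  have h4 : K.α K.one ^ 2 * lam n = 0 := by rw [← h3]; exact h2.symm
  exact (mul_eq_zero.mp h4).resolve_left (pow_ne_zero _ K.alpha_one_ne_zero.1)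

lemma exists_isRightInt (h0 : lam ≠ 0) :
    ∃ T : WithConv (A →ₗ[k] k), IsRightInt K.one T ∧ T ≠ 0 := by
  by_contra! hcon
  apply K.rightIntFamily_ne_zero h0
  refine WithConv.ext (TensorProduct.ext' fun n a => ?_)
  exact congr($(hcon _ (K.isRightInt_rightIntFamily hlam n)) a)

end LeftToRight
end Core

/-! ### From right integrals to left integrals -/

section Reverse
variable {k : Type u} {A : Type v} [Field k] [AddCommGroup A] [Module k A] [Coalgebra k A]

variable (k A) in
/-- `x ⊗ y ⊗ z ↦ z ⊗ y ⊗ x`, from the threefold tensor power of `A^cop` to that of `A`. -/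
def reverse : Cop A ⊗[k] (Cop A ⊗[k] Cop A) →ₗ[k] A ⊗[k] (A ⊗[k] A) :=
  ((TensorProduct.assoc k A A A).toLinearMap ∘ₗ (TensorProduct.comm k A (A ⊗[k] A)).toLinearMap ∘ₗ
    map LinearMap.id (TensorProduct.comm k A A).toLinearMap) ∘ₗ
    map (cop k A).symm.toLinearMap (map (cop k A).symm.toLinearMap (cop k A).symm.toLinearMap)

@[simp] lemma reverse_tmul (x y z : Cop A) : reverse k A (x ⊗ₜ (y ⊗ₜ z)) =
    (cop k A).symm z ⊗ₜ ((cop k A).symm y ⊗ₜ (cop k A).symm x) := by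
  simp [reverse]

lemma isAntiCoalgHom_reverse : IsAntiCoalgHom (reverse k A) :=
  (isCoalgHom_assoc.comp (isCoalgHom_comm.comp (IsCoalgHom.id.map isCoalgHom_comm))).comp_anti
    (isAntiCoalgHom_cop_symm.map (isAntiCoalgHom_cop_symm.map isAntiCoalgHom_cop_symm))

lemma convL_cop (β : A →ₗ[k] k) (a : A) :
    convL (β ∘ₗ (cop k A).symm.toLinearMap) LinearMap.id (cop k A a) =
      cop k A (convR LinearMap.id β a) := by
  simp only [convL, convR, LinearMap.comp_apply, comul_cop]
  induction (comul a : A ⊗[k] A) with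
  | zero => simp
  | add x y hx hy => simp only [map_add, hx, hy]
  | tmul x y => simp

lemma convR_cop (α : A →ₗ[k] k) (a : A) :
    convR LinearMap.id (α ∘ₗ (cop k A).symm.toLinearMap) (cop k A a) =
      cop k A (convL α LinearMap.id a) := by
  simp only [convL, convR, LinearMap.comp_apply, comul_cop]
  induction (comul a : A ⊗[k] A) with
  | zero => simp
  | add x y hx hy => simp only [map_add, hx, hy]
  | tmul x y => simp

end Reverse

namespace Core

variable {k : Type u} {A : Type v} [Field k] [AddCommGroup A] [Module k A] [Coalgebra k A]
variable (K : Core k A)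

/-- The opposite multiplication on `A^cop`. -/
def opMul : Cop A ⊗[k] Cop A →ₗ[k] Cop A :=
  ((cop k A).toLinearMap ∘ₗ K.mul ∘ₗ (TensorProduct.comm k A A).toLinearMap) ∘ₗ
    map (cop k A).symm.toLinearMap (cop k A).symm.toLinearMap

@[simp] lemma opMul_tmul (x y : Cop A) : K.opMul (x ⊗ₜ y) =
    cop k A (K.mul ((cop k A).symm y ⊗ₜ (cop k A).symm x)) := by
  simp [opMul]

/-- The opposite-co-opposite structure. The reassociator has its arguments reversed, and `α`, `β`
are exchanged. -/
def opCop : Core k (Cop A) where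
  mul := K.opMul
  isCoalgHom_mul :=
    (isAntiCoalgHom_cop.comp_hom (K.isCoalgHom_mul.comp isCoalgHom_comm)).comp
      (isAntiCoalgHom_cop_symm.map isAntiCoalgHom_cop_symm)
  one := cop k A K.one
  comul_one := by rw [comul_cop, K.comul_one]; simp
  counit_one := by rw [counit_cop, K.counit_one]
  one_mul a := by simp [K.mul_one]
  mul_one a := by simp [K.one_mul]
  φ := pull (reverse k A) K.φ
  quasi_assoc h := by
    have h1 : pull (mulRight K.opMul) h =
        pull (reverse k A) (pull (mulLeft K.mul) (pull (cop k A).toLinearMap h)) := by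
      rw [pull_pull, pull_pull]
      congr 1
      ext; simp [mulRight, mulLeft]
    have h2 : pull (mulLeft K.opMul) h =
        pull (reverse k A) (pull (mulRight K.mul) (pull (cop k A).toLinearMap h)) := by
      rw [pull_pull, pull_pull]
      congr 1
      ext; simp [mulRight, mulLeft]
    rw [h1, h2, ← pull_mul_anti isAntiCoalgHom_reverse, ← pull_mul_anti isAntiCoalgHom_reverse,
      K.quasi_assoc]
  φ_one a b := by
    obtain ⟨a, rfl⟩ := (cop k A).surjective a
    obtain ⟨b, rfl⟩ := (cop k A).surjective b
    rw [counit_cop, counit_cop, mul_comm, ← K.φ_one]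
    simp
  S := (cop k A).toLinearMap ∘ₗ K.S ∘ₗ (cop k A).symm.toLinearMap
  isAntiCoalgHom_S :=
    isAntiCoalgHom_cop.comp_hom (K.isAntiCoalgHom_S.comp isAntiCoalgHom_cop_symm)
  α := K.β ∘ₗ (cop k A).symm.toLinearMap
  β := K.α ∘ₗ (cop k A).symm.toLinearMap
  antipode_alpha a := by
    obtain ⟨a, rfl⟩ := (cop k A).surjective a
    have h := congr(cop k A $(K.beta_antipode a))
    rw [map_smul] at h
    refine Eq.trans ?_ h
    rw [comul_cop]
    induction (comul a : A ⊗[k] A) with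
    | zero => simp
    | add x y hx hy => simp only [map_add, hx, hy]
    | tmul x y => simp [convL_cop]
  beta_antipode a := by
    obtain ⟨a, rfl⟩ := (cop k A).surjective a
    have h := congr(cop k A $(K.antipode_alpha a))
    rw [map_smul] at h
    refine Eq.trans ?_ h
    rw [comul_cop]
    induction (comul a : A ⊗[k] A) with
    | zero => simp
    | add x y hx hy => simp only [map_add, hx, hy]
    | tmul x y => simp [convR_cop]
  zigzag := by
    refine LinearMap.ext fun a => ?_
    obtain ⟨a, rfl⟩ := (cop k A).surjective a
    have h := congr($(K.zigzag) a)
    rw [counit_cop, ← h]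
    have h1 : map (convR LinearMap.id K.β) (map K.S (convL K.α LinearMap.id) ∘ₗ comul) =
        map (convR LinearMap.id K.β) (map K.S (convL K.α LinearMap.id)) ∘ₗ
          LinearMap.lTensor A (comul (R := k) (A := A)) := by
      rw [LinearMap.lTensor, ← map_comp, LinearMap.comp_id]
    rw [h1]
    simp only [LinearMap.comp_apply, comul_cop]
    rw [← coassoc_apply]
    induction (comul a : A ⊗[k] A) with
    | zero => simp
    | add x y hx hy => simp only [map_add, hx, hy]
    | tmul x y =>
      simp only [map_tmul, LinearMap.rTensor_tmul, comm_tmul, LinearMap.comp_apply,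
        LinearEquiv.coe_coe, comul_cop, convR_cop]
      induction (comul x : A ⊗[k] A) with
      | zero => simp
      | add x y hx hy => simp only [map_add, tmul_add, add_tmul, hx, hy]
      | tmul x y => simp [convL_cop, pull]

lemma isLeftInt_opCop {T : WithConv (A →ₗ[k] k)} (hT : IsRightInt K.one T) :
    IsLeftInt K.opCop.one (pull (cop k A).symm.toLinearMap T) := fun h => by
  have h1 : h = pull (cop k A).symm.toLinearMap (pull (cop k A).toLinearMap h) := rfl
  rw [h1, ← pull_mul_anti isAntiCoalgHom_cop_symm, hT]
  rfl

lemma isLeftInt_of_opCop {T : WithConv (Cop A →ₗ[k] k)} (hT : IsRightInt K.opCop.one T) :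
    IsLeftInt K.one (pull (cop k A).toLinearMap T) := fun h => by
  have h1 : h = pull (cop k A).toLinearMap (pull (cop k A).symm.toLinearMap h) := rfl
  rw [h1, ← pull_mul_anti isAntiCoalgHom_cop, hT]
  rfl

lemma exists_isLeftInt {T : WithConv (A →ₗ[k] k)} (hT : IsRightInt K.one T) (h0 : T ≠ 0) :
    ∃ lam : WithConv (A →ₗ[k] k), IsLeftInt K.one lam ∧ lam ≠ 0 := by
  obtain ⟨lam, h1, h2⟩ := K.opCop.exists_isRightInt (K.isLeftInt_opCop hT) fun h =>
    h0 congr(pull (cop k A).toLinearMap $h)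
  exact ⟨_, K.isLeftInt_of_opCop h1, fun h => h2 congr(pull (cop k A).symm.toLinearMap $h)⟩

end Core

/-! ### Contractions with an extra tensor factor -/

namespace Core
variable {k : Type u} {A : Type v} [Field k] [AddCommGroup A] [Module k A] [Coalgebra k A]
variable (K : Core k A)
variable (D : Type*) [AddCommGroup D] [Module k D] [Coalgebra k D]

/-- `y ⊗ d ↦ S(y₁) ⊗ α(y₂) y₃ ⊗ d` -/
def alphaTens : A ⊗[k] D →ₗ[k] A ⊗[k] (A ⊗[k] D) :=
  (TensorProduct.assoc k A A D).toLinearMap ∘ₗ map (alphaContr K.S K.α) LinearMap.id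

/-- `x ⊗ d ↦ x₁ β(x₂) ⊗ S(x₃) ⊗ d` -/
def betaTens : A ⊗[k] D →ₗ[k] A ⊗[k] (A ⊗[k] D) :=
  (TensorProduct.assoc k A A D).toLinearMap ∘ₗ map (betaContr K.S K.β) LinearMap.id

lemma rCompat_alphaTens : RCompat (K.alphaTens D) (sndC k A (A ⊗[k] D)) LinearMap.id := by
  refine RCompat.comp_hom ?_ isCoalgHom_assoc
  rw [sndC_comp_assoc]
  have := (rCompat_alphaContr K.S K.α).map
    (RCompat.of_hom (IsCoalgHom.id (P := D) (k := k)) LinearMap.id)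
  rwa [LinearMap.id_comp, map_id] at this

lemma lCompat_alphaTens : LCompat (K.alphaTens D) (K.mulFst D) (map K.eta LinearMap.id) := by
  refine LCompat.comp_hom ?_ isCoalgHom_assoc
  rw [mulFst_comp_assoc]
  exact K.lCompat_alpha.map (LCompat.of_hom (IsCoalgHom.id (P := D) (k := k)) LinearMap.id)

lemma lCompat_betaTens : LCompat (K.betaTens D) (fstC k A (A ⊗[k] D)) (fstC k A D) := by
  refine LCompat.comp_hom ?_ isCoalgHom_assoc
  rw [fstC_comp_assoc]
  have := ((lCompat_betaContr K.S K.β).map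
    (LCompat.of_hom (IsCoalgHom.id (P := D) (k := k)) LinearMap.id)).postcomp (fstC k A D)
  rwa [LinearMap.id_comp, map_id] at this

lemma rCompat_betaTens : RCompat (K.betaTens D) (K.mulFst D) (map K.eta LinearMap.id) := by
  refine RCompat.comp_hom ?_ isCoalgHom_assoc
  rw [mulFst_comp_assoc]
  exact (rCompat_betaContr K.isAntiCoalgHom_S K.β K.mul K.one K.beta_antipode).map
    (RCompat.of_hom (IsCoalgHom.id (P := D) (k := k)) LinearMap.id)

lemma lCompat_betaTens_cop : LCompat (K.betaTens D ∘ₗ map (cop k A).symm.toLinearMap LinearMap.id)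
    (sndC k A (A ⊗[k] D)) (map K.Sc LinearMap.id) := by
  rw [betaTens, LinearMap.comp_assoc, ← map_comp]
  refine LCompat.comp_hom ?_ isCoalgHom_assoc
  rw [sndC_comp_assoc]
  exact (lCompat_betaContr_cop K.isAntiCoalgHom_S K.β).map
    (LCompat.of_hom (IsCoalgHom.id (P := D) (k := k)) LinearMap.id)

lemma convL_comp_convR : convL K.α LinearMap.id ∘ₗ convR LinearMap.id K.β =
    convR LinearMap.id K.β ∘ₗ convL K.α LinearMap.id := by
  have h : convL K.α LinearMap.id ∘ₗ (TensorProduct.rid k A).toLinearMap ∘ₗ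
      map LinearMap.id K.β = (TensorProduct.rid k A).toLinearMap ∘ₗ map LinearMap.id K.β ∘ₗ
      map (convL K.α LinearMap.id) LinearMap.id := by
    ext; simp
  conv_rhs => rw [convR, LinearMap.comp_assoc, LinearMap.comp_assoc, comul_comp_convL]
  exact congr($h ∘ₗ comul)

lemma betaContr_comp_convL : betaContr K.S K.β ∘ₗ convL K.α LinearMap.id =
    map (convL K.α LinearMap.id ∘ₗ convR LinearMap.id K.β) K.S ∘ₗ comul := by
  rw [betaContr, LinearMap.comp_assoc, comul_comp_convL, ← LinearMap.comp_assoc, ← map_comp,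
    LinearMap.comp_id, convL_comp_convR]

lemma map_betaContr_comp_alphaContr : (TensorProduct.assoc k A A A).toLinearMap ∘ₗ
      map (alphaContr K.S K.α) LinearMap.id ∘ₗ betaContr K.S K.β =
    map LinearMap.id (betaContr K.S K.β) ∘ₗ alphaContr K.S K.α := by
  have e1 : alphaContr K.S K.α ∘ₗ convR LinearMap.id K.β =
      map K.S (convL K.α LinearMap.id ∘ₗ convR LinearMap.id K.β) ∘ₗ comul := by
    rw [alphaContr, LinearMap.comp_assoc, comul_comp_convR, ← LinearMap.comp_assoc, ← map_comp,
      LinearMap.comp_id]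
  have e3 : map LinearMap.id (betaContr K.S K.β) ∘ₗ alphaContr K.S K.α =
      map K.S (map (convL K.α LinearMap.id ∘ₗ convR LinearMap.id K.β) K.S) ∘ₗ
        LinearMap.lTensor A comul ∘ₗ comul := by
    rw [alphaContr, LinearMap.lTensor, ← LinearMap.comp_assoc, ← LinearMap.comp_assoc,
      ← map_comp, ← map_comp, betaContr_comp_convL, LinearMap.comp_id, LinearMap.id_comp]
  have e4 : map (alphaContr K.S K.α) LinearMap.id ∘ₗ betaContr K.S K.β =
      map (map K.S (convL K.α LinearMap.id ∘ₗ convR LinearMap.id K.β)) K.S ∘ₗ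
        LinearMap.rTensor A comul ∘ₗ comul := by
    rw [betaContr, LinearMap.rTensor, ← LinearMap.comp_assoc, ← LinearMap.comp_assoc,
      ← map_comp, ← map_comp, e1, LinearMap.comp_id, LinearMap.id_comp]
  rw [e3, e4, ← coassoc]
  simp only [← LinearMap.comp_assoc]
  rw [← map_map_comp_assoc_eq]

lemma map_betaTens_comp_alphaTens : map LinearMap.id (K.betaTens D) ∘ₗ K.alphaTens D =
    K.alphaTens (A ⊗[k] D) ∘ₗ K.betaTens D := by
  have key := K.map_betaContr_comp_alphaContr
  refine TensorProduct.ext' fun a d => ?_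
  have h := congr(map (LinearMap.id : A →ₗ[k] A) (TensorProduct.assoc k A A D).toLinearMap
    (TensorProduct.assoc k A (A ⊗[k] A) D ($key a ⊗ₜ d)))
  simp only [LinearMap.comp_apply] at h
  simp only [LinearMap.comp_apply, alphaTens, betaTens, map_tmul, LinearMap.id_apply]
  refine Eq.trans ?_ (h.symm.trans ?_)
  · induction alphaContr K.S K.α a with
    | zero => simp
    | add x y hx hy => simp only [map_add, add_tmul, hx, hy]
    | tmul x y => simp
  · induction betaContr K.S K.β a with
    | zero => simp
    | add x y hx hy => simp only [map_add, add_tmul, hx, hy]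
    | tmul x y =>
      simp only [LinearEquiv.coe_coe, assoc_tmul, map_tmul, LinearMap.id_apply]
      induction alphaContr K.S K.α x with
      | zero => simp
      | add x y hx hy => simp only [map_add, add_tmul, hx, hy]
      | tmul x y => simp

end Core

/-! ### The contracted cocycle identity -/

namespace DualQuasiHopfAlgebra
variable {k : Type u} {A : Type v} [Field k] [AddCommGroup A] [Module k A] [Coalgebra k A]
variable (H : DualQuasiHopfAlgebra k A)

/-- A dual quasi-Hopf algebra, with the cocycle identity forgotten. -/
def core : Core k A where
  mul := H.mul.toLinearMap
  isCoalgHom_mul := isCoalgHom H.mul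
  one := H.unit 1
  comul_one := by
    have h := congr($(H.unit.map_comp_comul) 1)
    rw [LinearMap.comp_apply, CommSemiring.comul_apply, map_tmul] at h
    exact h.symm
  counit_one := by
    exact congr($(H.unit.counit_comp) 1)
  one_mul := H.one_mul
  mul_one := H.mul_one
  φ := H.reassoc.val
  quasi_assoc h := by
    refine (pull_convR _ _ _).trans (Eq.trans ?_ (pull_convL _ _ _).symm)
    rw [H.quasi_assoc]
  φ_one := H.reassoc_one
  S := H.antipode
  isAntiCoalgHom_S := ⟨H.counit_antipode, H.comul_antipode⟩
  α := H.alpha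
  β := H.beta
  antipode_alpha := H.antipode_alpha
  beta_antipode := H.beta_antipode
  zigzag := H.reassoc_antipode

/-- The convolution inverse of the reassociator. -/
def ψ : WithConv (A ⊗[k] (A ⊗[k] A) →ₗ[k] k) := (H.reassoc⁻¹).val

lemma φ_mul_ψ : H.core.φ * H.ψ = 1 := H.reassoc.mul_inv

lemma ψ_mul_φ : H.ψ * H.core.φ = 1 := H.reassoc.inv_mul

/-- `x ⊗ y ⊗ z ↦ x ⊗ y z` -/
def mulSnd : A ⊗[k] (A ⊗[k] A) →ₗ[k] A ⊗[k] A := map LinearMap.id H.core.mul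

@[simp] lemma mulSnd_tmul (x y z : A) :
    H.mulSnd (x ⊗ₜ (y ⊗ₜ z)) = x ⊗ₜ H.core.mul (y ⊗ₜ z) := rfl

lemma isCoalgHom_mulSnd : IsCoalgHom H.mulSnd := IsCoalgHom.id.map H.core.isCoalgHom_mul

/-- The cocycle identity, with all factors written as composites with coalgebra maps. -/
lemma cocycle_pull :
    pull (map LinearMap.id H.mulSnd) H.core.φ * pull (H.core.mulFst (A ⊗[k] A)) H.core.φ =
      pull (sndC k A (A ⊗[k] (A ⊗[k] A))) H.core.φ *
        pull (map LinearMap.id (H.core.mulFst A)) H.core.φ *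
        pull (map LinearMap.id (map LinearMap.id (fstC k A A))) H.core.φ := by
  have h := H.cocycle
  have e : toConv (assocEps1 H.reassoc.val.ofConv) =
      pull (sndC k A (A ⊗[k] (A ⊗[k] A))) H.core.φ := by
    refine WithConv.ext (TensorProduct.ext' fun x y => ?_)
    refine (?_ : _ = H.core.φ.ofConv _)
    rw [sndC_tmul, map_smul]
    simp [assocEps1, core]
  rw [e] at h
  exact h

/-- Put `b = 1` in the cocycle identity and cancel `φ`. -/
lemma one_tmul_φ (c d : A) :
    H.core.φ (H.core.one ⊗ₜ (c ⊗ₜ d)) = counit (R := k) c * counit (R := k) d := by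
  let j : A ⊗[k] (A ⊗[k] A) →ₗ[k] A ⊗[k] (A ⊗[k] (A ⊗[k] A)) :=
    map LinearMap.id (TensorProduct.mk k A (A ⊗[k] A) H.core.one)
  have hj : IsCoalgHom j := IsCoalgHom.id.map (isCoalgHom_mk H.core.comul_one H.core.counit_one)
  have h := congr(pull j $H.cocycle_pull)
  simp only [pull_mul hj, pull_pull] at h
  have h1 : pull (map LinearMap.id H.mulSnd ∘ₗ j) H.core.φ = 1 := by
    refine WithConv.ext (TensorProduct.ext_threefold' fun a c d => ?_)
    refine (H.core.φ_one _ _).trans ?_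
    simp [H.core.counit_mul, mul_comm]
  have h2 : H.core.mulFst (A ⊗[k] A) ∘ₗ j = LinearMap.id :=
    TensorProduct.ext_threefold' fun a c d => by simp [j, H.core.mul_one]
  have h3 : map LinearMap.id (H.core.mulFst A) ∘ₗ j = LinearMap.id :=
    TensorProduct.ext_threefold' fun a c d => by simp [j, H.core.one_mul]
  have h4 : pull (map LinearMap.id (map LinearMap.id (fstC k A A)) ∘ₗ j) H.core.φ = 1 := by
    refine WithConv.ext (TensorProduct.ext_threefold' fun a c d => ?_)
    refine (H.core.φ_one _ _).trans ?_
    simp [mul_comm]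
  rw [h1, h2, h3, h4, one_mul, mul_one, pull_id] at h
  have h5 := congr($h * H.ψ)
  rw [mul_assoc, H.φ_mul_ψ, mul_one] at h5
  have h6 := congr($h5 (H.core.one ⊗ₜ (c ⊗ₜ d)))
  simpa [j, H.core.counit_one, mul_comm] using h6.symm

/-- Put `c = 1` in the cocycle identity and cancel `φ`. -/
lemma φ_tmul_one (a b : A) :
    H.core.φ (a ⊗ₜ (b ⊗ₜ H.core.one)) = counit (R := k) a * counit (R := k) b := by
  let j : A ⊗[k] (A ⊗[k] A) →ₗ[k] A ⊗[k] (A ⊗[k] (A ⊗[k] A)) :=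
    map LinearMap.id (map LinearMap.id (TensorProduct.mk k A A H.core.one))
  have hj : IsCoalgHom j :=
    IsCoalgHom.id.map (IsCoalgHom.id.map (isCoalgHom_mk H.core.comul_one H.core.counit_one))
  have h := congr(pull j $H.cocycle_pull)
  simp only [pull_mul hj, pull_pull] at h
  have h1 : map LinearMap.id H.mulSnd ∘ₗ j = LinearMap.id :=
    TensorProduct.ext_threefold' fun a c d => by simp [j, H.core.one_mul]
  have h2 : pull (H.core.mulFst (A ⊗[k] A) ∘ₗ j) H.core.φ = 1 := by
    refine WithConv.ext (TensorProduct.ext_threefold' fun a c d => ?_)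
    refine (H.core.φ_one _ _).trans ?_
    simp [H.core.counit_mul, mul_comm, mul_left_comm]
  have h3 : map LinearMap.id (H.core.mulFst A) ∘ₗ j = LinearMap.id :=
    TensorProduct.ext_threefold' fun a c d => by simp [j, H.core.mul_one]
  have h4 : pull (sndC k A (A ⊗[k] (A ⊗[k] A)) ∘ₗ j) H.core.φ = 1 := by
    refine WithConv.ext (TensorProduct.ext_threefold' fun a c d => ?_)
    refine congr(H.core.φ $(sndC_tmul (k := k) _ _)).trans ?_
    refine (map_smul H.core.φ.ofConv _ _).trans ?_
    refine congr(_ * $(H.core.φ_one _ _)).trans ?_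
    simp [mul_comm]
  rw [h1, h2, h3, h4, one_mul, mul_one, pull_id] at h
  have h5 := congr(H.ψ * $h)
  rw [← mul_assoc, H.ψ_mul_φ, one_mul] at h5
  have h6 := congr($h5 (a ⊗ₜ (b ⊗ₜ H.core.one)))
  simpa [j, H.core.counit_one, mul_comm] using h6.symm

lemma ψ_tmul_one (a b : A) :
    H.ψ (a ⊗ₜ (b ⊗ₜ H.core.one)) = counit (R := k) a * counit (R := k) b := by
  have hj : IsCoalgHom (map (LinearMap.id : A →ₗ[k] A)
      ((TensorProduct.mk k A A).flip H.core.one)) :=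
    IsCoalgHom.id.map (isCoalgHom_mk_flip H.core.comul_one H.core.counit_one)
  have h := congr(pull (map (LinearMap.id : A →ₗ[k] A)
      ((TensorProduct.mk k A A).flip H.core.one)) $H.φ_mul_ψ)
  have h1 : pull (map (LinearMap.id : A →ₗ[k] A)
      ((TensorProduct.mk k A A).flip H.core.one)) H.core.φ = 1 := by
    refine WithConv.ext (TensorProduct.ext' fun a b => (H.φ_tmul_one a b).trans ?_)
    simp [mul_comm]
  rw [pull_mul hj, h1, one_mul, pull_one hj] at h
  refine congr($h (a ⊗ₜ b)).trans ?_
  simp [mul_comm]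

/-- `χ(z ⊗ a) = ψ(S(z₁) ⊗ α(z₂) z₃ ⊗ a)` -/
def χ : WithConv (A ⊗[k] A →ₗ[k] k) := pull (H.core.alphaTens A) H.ψ

lemma χ_tmul_one (z : A) : H.χ (z ⊗ₜ H.core.one) = H.alpha z := by
  have h (x : A ⊗[k] A) : H.ψ.ofConv (TensorProduct.assoc k A A A (x ⊗ₜ H.core.one)) =
      LinearMap.mul' k k (map counit counit x) := by
    induction x with
    | zero => simp
    | add x y hx hy => simp only [map_add, add_tmul, hx, hy]
    | tmul x y => exact H.ψ_tmul_one x y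
  refine (h (alphaContr H.antipode H.alpha z)).trans ?_
  have h2 : counit (R := k) ∘ₗ convL H.alpha LinearMap.id = H.alpha := by
    ext a
    conv_rhs => rw [← counit_smul_comul_right (k := k) a]
    simp only [convL, LinearMap.comp_apply]
    induction (comul a : A ⊗[k] A) with
    | zero => simp
    | add x y hx hy => simp only [map_add, hx, hy]
    | tmul x y => simp [mul_comm]
  rw [alphaContr, LinearMap.comp_apply, ← LinearMap.comp_apply (map _ _), ← map_comp,
    H.counit_antipode, h2]
  conv_rhs => rw [← counit_smul_comul_left (k := k) z]
  induction (comul z : A ⊗[k] A) with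
  | zero => simp
  | add x y hx hy => simp only [map_add, hx, hy]
  | tmul x y => simp

/-- A reformulation of `∑ ψ(S(a₁), α(a₂) a₃, β(a₄) S(a₅)) = ε(a)`. -/
lemma pull_alphaTens_comp_betaTens :
    pull (H.core.betaTens A) (pull (H.core.alphaTens (A ⊗[k] A))
      (pull (map LinearMap.id (map LinearMap.id (fstC k A A))) H.ψ)) = 1 := by
  have key : map LinearMap.id (betaContr H.antipode H.beta) ∘ₗ
      alphaContr H.antipode H.alpha = map H.antipode
          (map (convL H.alpha LinearMap.id) (convL H.beta H.antipode) ∘ₗ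
            Coalgebra.comul) ∘ₗ Coalgebra.comul := by
    have e1 := H.core.betaContr_comp_convL
    have e2 : map (convR LinearMap.id H.beta) H.antipode ∘ₗ comul =
        map LinearMap.id (convL H.beta H.antipode) ∘ₗ comul := by
      have f1 : map LinearMap.id (convL H.beta H.antipode) ∘ₗ (comul : A →ₗ[k] A ⊗[k] A) =
          map LinearMap.id ((TensorProduct.lid k A).toLinearMap ∘ₗ map H.beta H.antipode) ∘ₗ
            LinearMap.lTensor A comul ∘ₗ comul := by
        rw [LinearMap.lTensor, ← LinearMap.comp_assoc, ← map_comp]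
        rfl
      rw [f1, ← coassoc]
      simp only [← LinearMap.comp_assoc]
      congr 1
      refine TensorProduct.ext' fun x y => ?_
      simp only [convR, LinearMap.comp_apply, map_tmul, LinearMap.rTensor_tmul]
      induction (comul x : A ⊗[k] A) with
      | zero => simp
      | add x y hx hy => simp only [map_add, add_tmul, hx, hy]
      | tmul x y => simp [smul_tmul]
    have e3 := congr(map (convL H.alpha LinearMap.id) LinearMap.id ∘ₗ $e2)
    simp only [← LinearMap.comp_assoc, ← map_comp, LinearMap.comp_id, LinearMap.id_comp] at e3
    rw [alphaContr, ← LinearMap.comp_assoc, ← map_comp, LinearMap.id_comp, ← e3]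
    exact congr(map H.antipode $e1 ∘ₗ comul)
  have h : H.ψ.ofConv ∘ₗ map LinearMap.id (betaContr H.antipode H.beta) ∘ₗ
      alphaContr H.antipode H.alpha = counit := by
    rw [key]
    exact H.reassoc_inv_antipode
  rw [pull_pull, pull_pull, ← H.core.map_betaTens_comp_alphaTens, ← LinearMap.comp_assoc]
  refine WithConv.ext (TensorProduct.ext' fun a d => ?_)
  have h2 : map LinearMap.id (map LinearMap.id (fstC k A A)) ∘ₗ
      map LinearMap.id (H.core.betaTens A) =
      map (LinearMap.id : A →ₗ[k] A) (betaContr H.antipode H.beta ∘ₗ fstC k A A) := by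
    rw [← map_comp, LinearMap.id_comp]
    congr 1
    refine TensorProduct.ext' fun a d => ?_
    simp only [LinearMap.comp_apply, Core.betaTens, map_tmul, LinearMap.id_apply, fstC_tmul,
      map_smul]
    refine Eq.trans (b := map LinearMap.id (fstC k A A) (TensorProduct.assoc k A A A
      (betaContr H.antipode H.beta a ⊗ₜ d))) rfl ?_
    induction betaContr H.antipode H.beta a with
    | zero => simp
    | add x y hx hy => simp only [map_add, add_tmul, smul_add, hx, hy]
    | tmul x y => simp
  have h3 : map (LinearMap.id : A →ₗ[k] A) (fstC k A A) (H.core.alphaTens A (a ⊗ₜ d)) =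
      counit (R := k) d • alphaContr H.antipode H.alpha a := by
    refine Eq.trans (b := map LinearMap.id (fstC k A A) (TensorProduct.assoc k A A A
      (alphaContr H.antipode H.alpha a ⊗ₜ d))) rfl ?_
    induction alphaContr H.antipode H.alpha a with
    | zero => simp
    | add x y hx hy => simp only [map_add, add_tmul, smul_add, hx, hy]
    | tmul x y => simp
  rw [h2]
  have h4 : map (LinearMap.id : A →ₗ[k] A) (betaContr H.antipode H.beta ∘ₗ fstC k A A) =
      map LinearMap.id (betaContr H.antipode H.beta) ∘ₗ map LinearMap.id (fstC k A A) := by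
    rw [← map_comp, LinearMap.comp_id]
  rw [h4]
  refine congr(H.ψ.ofConv (map LinearMap.id (betaContr H.antipode H.beta) $h3)).trans ?_
  rw [map_smul, map_smul]
  refine congr(_ * $h a).trans ?_
  simp

/-- The cocycle identity, rewritten as `ψ(x, y, z d) * ε(x) φ(y, z, d) * φ(x, y z, d) =
φ(x y, z, d) * ψ(x, y, z) ε(d)` and contracted twice: the `β`-contraction of `y ⊗ z` removes the
factor `φ(x, y z, d)`, and the `α`-contraction of `x ⊗ y` removes `φ(x y, z, d)`. -/
lemma pull_betaTens_χ :
    pull (H.core.betaTens A) (pull H.mulSnd H.χ * H.core.φ) = 1 := by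
  have hA34 : IsCoalgHom (map (LinearMap.id : A →ₗ[k] A) H.mulSnd) :=
    IsCoalgHom.id.map H.isCoalgHom_mulSnd
  have hE4 : IsCoalgHom (map (LinearMap.id : A →ₗ[k] A) (map (LinearMap.id : A →ₗ[k] A)
      (fstC k A A))) := IsCoalgHom.id.map (IsCoalgHom.id.map isCoalgHom_fstC)
  have c1 := H.cocycle_pull
  set Φ := H.core.φ with hΦ
  have c2 : pull (map LinearMap.id H.mulSnd) H.ψ * pull (sndC k A (A ⊗[k] (A ⊗[k] A))) Φ *
        pull (map LinearMap.id (H.core.mulFst A)) Φ = pull (H.core.mulFst (A ⊗[k] A)) Φ *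
        pull (map LinearMap.id (map LinearMap.id (fstC k A A))) H.ψ := by
    have d1 : pull (map LinearMap.id H.mulSnd) H.ψ * pull (map LinearMap.id H.mulSnd) Φ = 1 := by
      rw [← pull_mul hA34, H.ψ_mul_φ, pull_one hA34]
    have d2 : pull (map (LinearMap.id : A →ₗ[k] A) (map (LinearMap.id : A →ₗ[k] A)
      (fstC k A A))) Φ * pull (map LinearMap.id (map LinearMap.id (fstC k A A))) H.ψ = 1 := by
      rw [← pull_mul hE4, H.φ_mul_ψ, pull_one hE4]
    have d3 := congr(pull (map LinearMap.id H.mulSnd) H.ψ * $c1 *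
      pull (map LinearMap.id (map LinearMap.id (fstC k A A))) H.ψ)
    rw [← mul_assoc, d1, one_mul] at d3
    rw [d3]
    simp only [mul_assoc]
    rw [d2, mul_one]
  have c3 := congr(pull (map LinearMap.id (H.core.betaTens A) ∘ₗ H.core.alphaTens A) $c2)
  have hR : RCompat (map (LinearMap.id : A →ₗ[k] A) (H.core.betaTens A))
      (map LinearMap.id (H.core.mulFst A)) (map LinearMap.id (map H.core.eta LinearMap.id)) :=
    (RCompat.of_hom IsCoalgHom.id LinearMap.id).map (H.core.rCompat_betaTens A)
  have u1 : pull (map (LinearMap.id : A →ₗ[k] A) (map H.core.eta LinearMap.id)) Φ =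
      (1 : WithConv (A ⊗[k] (A ⊗[k] A) →ₗ[k] k)) := by
    refine WithConv.ext (TensorProduct.ext_threefold' fun a b c => ?_)
    have e : map LinearMap.id (map H.core.eta LinearMap.id) (a ⊗ₜ (b ⊗ₜ c)) =
        counit (R := k) b • a ⊗ₜ (H.core.one ⊗ₜ c) := by
      simp [Core.eta, ← smul_tmul']
    refine congr(H.core.φ.ofConv $e).trans ?_
    rw [map_smul]
    refine congr(_ * $(H.core.φ_one _ _)).trans ?_
    simp [mul_comm, mul_left_comm]
  have u2 : pull (map H.core.eta LinearMap.id) Φ =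
      (1 : WithConv (A ⊗[k] (A ⊗[k] A) →ₗ[k] k)) := by
    refine WithConv.ext (TensorProduct.ext_threefold' fun a b c => ?_)
    have e : map H.core.eta (LinearMap.id : A ⊗[k] A →ₗ[k] _) (a ⊗ₜ (b ⊗ₜ c)) =
        counit (R := k) a • H.core.one ⊗ₜ (b ⊗ₜ c) := by
      simp [Core.eta, ← smul_tmul']
    refine congr(H.core.φ.ofConv $e).trans ?_
    rw [map_smul]
    refine congr(_ * $(H.one_tmul_φ _ _)).trans ?_
    simp [mul_comm]
  rw [← pull_pull, hR.pull_mul, u1, mul_one, pull_pull, H.core.map_betaTens_comp_alphaTens,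
    ← pull_pull, ← pull_pull, (H.core.lCompat_alphaTens (A ⊗[k] A)).pull_mul, u2, one_mul,
    (H.core.rCompat_alphaTens (A ⊗[k] A)).pull_mul, pull_alphaTens_comp_betaTens, pull_id] at c3
  have e : H.core.alphaTens A ∘ₗ H.mulSnd =
      map LinearMap.id H.mulSnd ∘ₗ H.core.alphaTens (A ⊗[k] A) := by
    refine TensorProduct.ext_threefold' fun a b c => ?_
    simp only [LinearMap.comp_apply, mulSnd_tmul, Core.alphaTens, map_tmul, LinearMap.id_apply]
    induction alphaContr H.core.S H.core.α a with
    | zero => simp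
    | add x y hx hy => simp only [map_add, add_tmul, hx, hy]
    | tmul x y => simp
  rw [← c3, χ, pull_pull, e, ← pull_pull]

end DualQuasiHopfAlgebra

/-! ### The pairing attached to a right integral -/

namespace DualQuasiHopfAlgebra
variable {k : Type u} {A : Type v} [Field k] [AddCommGroup A] [Module k A] [Coalgebra k A]
variable (H : DualQuasiHopfAlgebra k A)

/-- The form `χ(y, a) * T(y a)` on `A ⊗ A`. -/
def twistR (T : WithConv (A →ₗ[k] k)) : WithConv (A ⊗[k] A →ₗ[k] k) :=
  H.χ * pull H.core.mul T

/-- The form `B` on `A ⊗ A` attached to `T`: the contraction of `ε(x) t(y, a) * φ(x, y, a)`. -/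
def pairing (T : WithConv (A →ₗ[k] k)) : WithConv (A ⊗[k] A →ₗ[k] k) :=
  pull (H.core.betaTens A) (pull (sndC k A (A ⊗[k] A)) (H.twistR T) * H.core.φ)

lemma pairing_add (T T' : WithConv (A →ₗ[k] k)) :
    H.pairing (T + T') = H.pairing T + H.pairing T' := by
  simp only [pairing, twistR, pull_add, mul_add, add_mul]

lemma pairing_smul (c : k) (T : WithConv (A →ₗ[k] k)) :
    H.pairing (c • T) = c • H.pairing T := by
  simp only [pairing, twistR, pull_smul, mul_smul_comm, smul_mul_assoc]

variable {H} {T : WithConv (A →ₗ[k] k)} (hT : IsRightInt H.core.one T)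
include hT

lemma twistR_mul (h : WithConv (A →ₗ[k] k)) :
    H.twistR T * pull H.core.mul h = h H.core.one • H.twistR T := by
  rw [twistR, mul_assoc, ← pull_mul H.core.isCoalgHom_mul, hT, pull_smul, mul_smul_comm]

/-- Since `t` absorbs forms of the shape `h(y a)` into the value `h(1)`, multiplying `t(y, a)` by
`Z(x, y a)` amounts to multiplying it by `Z(x, 1)`. -/
lemma pull_sndC_twistR_mul (Z : WithConv (A ⊗[k] A →ₗ[k] k)) :
    pull (sndC k A (A ⊗[k] A)) (H.twistR T) * pull H.mulSnd Z =
      pull (fstC k A (A ⊗[k] A)) (pull ((TensorProduct.mk k A A).flip H.core.one) Z) *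
        pull (sndC k A (A ⊗[k] A)) (H.twistR T) := by
  refine WithConv.ext (TensorProduct.ext' fun x w => ?_)
  have h1 := congr($((lCompat_mk x).pull_mul (H.twistR T) (pull H.mulSnd Z)) w)
  have h2 : pull (TensorProduct.mk k A (A ⊗[k] A) x) (pull H.mulSnd Z) =
      pull H.core.mul (pull (TensorProduct.mk k A A x) Z) := by
    rw [pull_pull, pull_pull]
    rfl
  rw [h2, pull_id, twistR_mul hT] at h1
  rw [pull_apply] at h1
  rw [pull_fstC_mul_pull_sndC_apply]
  exact h1

lemma pull_fstC_mul_pairing (h : WithConv (A →ₗ[k] k)) :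
    pull (fstC k A A) h * H.pairing T = H.pairing T * pull (sndC k A A) h := by
  have h1 := pull_sndC_twistR_mul hT (pull H.core.mul h)
  have h2 : pull ((TensorProduct.mk k A A).flip H.core.one) (pull H.core.mul h) = h := by
    ext a; simp [H.core.mul_one]
  have h3 : pull H.mulSnd (pull H.core.mul h) = pull (mulRight H.core.mul) h := rfl
  rw [h2, h3] at h1
  have h4 := ((H.core.rCompat_betaTens A).postcomp H.core.mul)
  rw [H.core.mul_comp_map_eta_id] at h4
  rw [pairing, ← (H.core.lCompat_betaTens A).pull_mul, ← mul_assoc, ← h1, mul_assoc,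
    H.core.quasi_assoc, ← mul_assoc]
  exact h4.pull_mul _ _

lemma pull_fstC_alpha_mul_pairing :
    pull (fstC k A A) (toConv H.alpha) * H.pairing T =
      pull (map H.antipode LinearMap.id) (H.twistR T) := by
  have h1 := pull_sndC_twistR_mul hT H.χ
  have h2 : pull ((TensorProduct.mk k A A).flip H.core.one) H.χ = toConv H.alpha :=
    WithConv.ext (LinearMap.ext H.χ_tmul_one)
  rw [h2] at h1
  rw [pairing, ← (H.core.lCompat_betaTens A).pull_mul, ← mul_assoc, ← h1, mul_assoc]
  have h3 := (H.core.lCompat_betaTens_cop A).pull_mul (H.twistR T) (pull H.mulSnd H.χ * H.core.φ)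
  have h4 : pull (map (cop k A).symm.toLinearMap LinearMap.id)
      (1 : WithConv (A ⊗[k] A →ₗ[k] k)) = 1 := WithConv.ext (TensorProduct.ext' fun x a => rfl)
  rw [← pull_pull _ _ (_ * _), ← pull_pull _ (H.core.betaTens A), H.pull_betaTens_χ,
    h4, mul_one] at h3
  refine WithConv.ext (TensorProduct.ext' fun x a => ?_)
  exact congr($h3 (cop k A x ⊗ₜ a))

lemma pull_betaTens_twistR :
    pull (H.core.betaTens A) (pull H.mulSnd (H.twistR T) * H.core.φ) = pull (sndC k A A) T := by
  have h4 := ((H.core.rCompat_betaTens A).postcomp H.core.mul)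
  rw [H.core.mul_comp_map_eta_id] at h4
  have h3 : pull H.mulSnd (pull H.core.mul T) = pull (mulRight H.core.mul) T := rfl
  rw [twistR, pull_mul H.isCoalgHom_mulSnd, h3, mul_assoc, H.core.quasi_assoc, ← mul_assoc]
  refine (h4.pull_mul _ _).trans ?_
  rw [H.pull_betaTens_χ, one_mul]

/-- If `B(x, 1) = 0`, then `B(y, ·) = 0` for `y = ∑ λ(x₁) x₂`, and this propagates to the tensor
factors of `Δ(y)`. -/
lemma pairing_ne_zero {lam : WithConv (A →ₗ[k] k)} (hlam : IsLeftInt H.core.one lam) (h0 : T ≠ 0)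
    {x : A} (hx : lam x ≠ 0) : H.pairing T (x ⊗ₜ H.core.one) ≠ 0 := by
  intro hB
  let y := convL lam.ofConv LinearMap.id x
  have hy (a : A) : H.pairing T (y ⊗ₜ a) = 0 := by
    rw [← pull_fstC_mul_apply lam, pull_fstC_mul_pairing hT, mul_pull_sndC_apply, hlam]
    exact congr($hB * lam a).trans (zero_mul _)
  have hεy : counit (R := k) y = lam x := by
    have h := congr(lam.ofConv $(counit_smul_comul_right (k := k) x))
    rw [← h]
    simp only [y, convL, LinearMap.comp_apply]
    induction (comul x : A ⊗[k] A) with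
    | zero => simp
    | add x y hx hy => simp only [map_add, hx, hy]
    | tmul x y => simp [mul_comm]
  let b := Module.Basis.ofVectorSpace k A
  obtain ⟨c, hc⟩ := TensorProduct.eq_repr_basis_left b (comul (R := k) y)
  have hv (h : WithConv (A →ₗ[k] k)) (v : A) (hv : ∀ a, H.pairing T (v ⊗ₜ a) = 0) (a : A) :
      (pull (fstC k A A) h * H.pairing T) (v ⊗ₜ a) = 0 := by
    have : pull (TensorProduct.mk k A A v) (H.pairing T) = 0 := WithConv.ext (LinearMap.ext hv)
    rw [pull_fstC_mul_pairing hT, mul_pull_sndC_apply, this, zero_mul]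
    rfl
  -- The second tensor factors of `Δ(y)` relative to a basis are again in the left kernel of `B`.
  have hci (i a) : H.pairing T (c i ⊗ₜ a) = 0 := by
    have h1 := hv (toConv (b.coord i)) y hy a
    rw [pull_fstC_mul_apply] at h1
    have h2 : convL (b.coord i) LinearMap.id y = c i := by
      classical
      rw [convL, LinearMap.comp_apply, LinearMap.comp_apply, ← hc, Finsupp.sum, map_sum, map_sum]
      simp only [map_tmul, Module.Basis.coord_apply, Module.Basis.repr_self, lid_tmul,
        Finsupp.single_apply, LinearEquiv.coe_coe, LinearMap.id_apply, ite_smul, one_smul,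
        zero_smul, Finset.sum_ite_eq', Finsupp.mem_support_iff, ite_not]
      split_ifs with h <;> simp [h]
    rwa [ofConv_toConv, h2] at h1
  have hti (i a) : H.twistR T (H.antipode (c i) ⊗ₜ a) = 0 := by
    rw [← hv (toConv H.alpha) (c i) (hci i) a, pull_fstC_alpha_mul_pairing hT]
    rfl
  apply h0
  refine WithConv.ext (LinearMap.ext fun a => ?_)
  -- `∑ t(S(y)₁, M(S(y)₂, a)) = ε(y) T(a)` for a certain linear map `M`; as `S` reverses the
  -- comultiplication, the first arguments of `t` are the elements `S(c i)`.
  have hD := pull_betaTens_twistR hT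
  rw [mulSnd, pull_map_id_mul, pull_pull, LinearMap.comp_assoc, LinearMap.comp_assoc,
    map_id_comp_assoc_comul (H.core.lCompat_betaTens A), ← LinearMap.comp_assoc, ← map_comp] at hD
  have hD2 := congr($hD (H.antipode y ⊗ₜ a))
  have hεS : counit (R := k) (H.antipode y) = counit (R := k) y := congr($H.counit_antipode y)
  have hΔS : comul (R := k) (H.antipode y) = c.sum fun i n => H.antipode n ⊗ₜ H.antipode (b i) := by
    have h := congr($H.comul_antipode y)
    simp only [LinearMap.comp_apply] at h
    rw [h, ← hc]
    simp [Finsupp.sum]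
  have hr : pull (sndC k A A) T (H.antipode y ⊗ₜ a) = lam x * T a := by
    rw [pull_apply, sndC_tmul, map_smul, hεS, hεy, smul_eq_mul]
  rw [hr] at hD2
  refine (mul_eq_zero.mp (hD2.symm.trans ?_)).resolve_left hx
  rw [pull_apply]
  simp only [LinearMap.comp_apply, map_tmul, hΔS, Finsupp.sum, sum_tmul, map_sum]
  exact Finset.sum_eq_zero fun i _ => hti i _

end DualQuasiHopfAlgebra

end DualQuasi

/-! ### The spaces of integrals -/

namespace DualQuasi.DualQuasiHopfAlgebra

variable {k : Type u} {A : Type v} [Field k] [AddCommGroup A] [Module k A] [Coalgebra k A]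
variable (H : DualQuasiHopfAlgebra k A)

lemma mem_leftIntegrals {T : A →ₗ[k] k} :
    T ∈ H.leftIntegrals ↔ IsLeftInt H.core.one (toConv T) :=
  ⟨fun h f => h f.ofConv, fun h f => h (toConv f)⟩

lemma mem_rightIntegrals {T : A →ₗ[k] k} :
    T ∈ H.rightIntegrals ↔ IsRightInt H.core.one (toConv T) :=
  ⟨fun h f => h f.ofConv, fun h f => h (toConv f)⟩

lemma pairing_ne_zero_of_mem {l T : A →ₗ[k] k} (hl : l ∈ H.leftIntegrals)
    (hT : T ∈ H.rightIntegrals) (hT0 : T ≠ 0) {x : A} (hx : l x ≠ 0) :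
    H.pairing (toConv T) (x ⊗ₜ H.core.one) ≠ 0 :=
  pairing_ne_zero (H.mem_rightIntegrals.1 hT) (H.mem_leftIntegrals.1 hl)
    (fun h => hT0 congr(ofConv $h)) hx

variable {l T : A →ₗ[k] k} (hl : l ∈ H.leftIntegrals) (hl0 : l ≠ 0)
  (hT : T ∈ H.rightIntegrals) (hT0 : T ≠ 0)
include hl hl0 hT hT0

lemma rank_leftIntegrals : Module.rank k H.leftIntegrals = 1 := by
  obtain ⟨x, hx⟩ : ∃ x, l x ≠ 0 := by
    by_contra! h
    exact hl0 (LinearMap.ext h)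
  refine rank_eq_one (⟨l, hl⟩ : H.leftIntegrals) (fun h => hl0 congr($h.1)) ?_
  rintro ⟨l', hl'⟩
  refine ⟨l' x / l x, Subtype.ext (Eq.symm (sub_eq_zero.mp ?_))⟩
  by_contra hne
  obtain ⟨z, hz⟩ : ∃ z, (l' - (l' x / l x) • l) z ≠ 0 := by
    by_contra! h
    exact hne (LinearMap.ext h)
  have hmem := H.leftIntegrals.sub_mem hl' (H.leftIntegrals.smul_mem (l' x / l x) hl)
  have hx0 : (l' - (l' x / l x) • l) x = 0 := by simp [hx]
  let f := H.pairing (toConv T)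
  have hfx : f (x ⊗ₜ H.core.one) ≠ 0 := H.pairing_ne_zero_of_mem hl hT hT0 hx
  -- The integral `l' - (l' x / l x) • l` kills `x`, so it is also nonzero at the translate of `z`
  -- by a multiple of `x` at which the pairing with `1` vanishes.
  refine H.pairing_ne_zero_of_mem hmem hT hT0
    (x := z - (f (z ⊗ₜ H.core.one) / f (x ⊗ₜ H.core.one)) • x) ?_ ?_
  · rwa [map_sub, map_smul, hx0, smul_zero, sub_zero]
  · rw [sub_tmul, ← smul_tmul', map_sub, map_smul, smul_eq_mul, div_mul_cancel₀ _ hfx, sub_self]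

lemma rank_rightIntegrals : Module.rank k H.rightIntegrals = 1 := by
  obtain ⟨x, hx⟩ : ∃ x, l x ≠ 0 := by
    by_contra! h
    exact hl0 (LinearMap.ext h)
  refine rank_eq_one (⟨T, hT⟩ : H.rightIntegrals) (fun h => hT0 congr($h.1)) ?_
  rintro ⟨T', hT'⟩
  let f (T : A →ₗ[k] k) := H.pairing (toConv T) (x ⊗ₜ H.core.one)
  have hfT : f T ≠ 0 := H.pairing_ne_zero_of_mem hl hT hT0 hx
  refine ⟨f T' / f T, Subtype.ext (Eq.symm (sub_eq_zero.mp ?_))⟩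
  by_contra hne
  have hmem := H.rightIntegrals.sub_mem hT' (H.rightIntegrals.smul_mem (f T' / f T) hT)
  refine H.pairing_ne_zero_of_mem hl hmem hne hx ?_
  have h1 : f (T' - (f T' / f T) • T) = f T' - (f T' / f T) * f T := by
    have : toConv (T' - (f T' / f T) • T) = toConv T' + (-(f T' / f T)) • toConv T := by
      rw [neg_smul, ← sub_eq_add_neg]
      rfl
    simp only [f]
    rw [this, pairing_add, pairing_smul, sub_eq_add_neg, ← neg_mul]
    rfl
  exact h1.trans (by rw [div_mul_cancel₀ _ hfT, sub_self])

end DualQuasi.DualQuasiHopfAlgebra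

end

theorem proposition4p7 {k : Type u} {A : Type v} [Field k] [AddCommGroup A] [Module k A]
    [Coalgebra k A] (H : DualQuasi.DualQuasiHopfAlgebra k A)
    (hint : (∃ T ∈ H.leftIntegrals, T ≠ 0) ∨ (∃ T ∈ H.rightIntegrals, T ≠ 0)) :
    Module.rank k H.leftIntegrals = 1 ∧ Module.rank k H.rightIntegrals = 1 := by
  obtain ⟨⟨l, hl, hl0⟩, ⟨T, hT, hT0⟩⟩ :
      (∃ l ∈ H.leftIntegrals, l ≠ 0) ∧ ∃ T ∈ H.rightIntegrals, T ≠ 0 := by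
    rcases hint with ⟨l, hl, hl0⟩ | ⟨T, hT, hT0⟩
    · obtain ⟨T, hT, hT0⟩ := H.core.exists_isRightInt (H.mem_leftIntegrals.1 hl)
        fun h => hl0 congr(ofConv $h)
      exact ⟨⟨l, hl, hl0⟩, T.ofConv, H.mem_rightIntegrals.2 hT, fun h => hT0 congr(toConv $h)⟩
    · obtain ⟨l, hl, hl0⟩ := H.core.exists_isLeftInt (H.mem_rightIntegrals.1 hT)
        fun h => hT0 congr(ofConv $h)
      exact ⟨⟨l.ofConv, H.mem_leftIntegrals.2 hl, fun h => hl0 congr(toConv $h)⟩, T, hT, hT0⟩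
  exact ⟨H.rank_leftIntegrals hl hl0 hT hT0, H.rank_rightIntegrals hl hl0 hT hT0⟩
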